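/- Let $a>0$ be fixed and let $m\in\{1/3,\,1/2,\,\infty\}$ (for $m=\infty$ the coefficients $(m-1)/m$ and $(2m-1)/m$ are read as $1$ and $2$). Consider on $\mathbb{R}_-=(-\infty,0]$ the singular boundary value problem (BVP) $$(\Phi''+\Phi\Phi')'=\frac{2m-1}{m}(\Phi')^2,\qquad \Phi(0)=0,$$ $$\lim_{\tau\to-\infty}e^{-\varepsilon\tau}\bigl(\Phi(\tau)+a\bigr)=\lim_{\tau\to-\infty}e^{-\varepsilon\tau}\Phi'(\tau)=\lim_{\tau\to-\infty}e^{-\varepsilon\tau}\Phi''(\tau)=0\quad\text{for all }0<\varepsilon<a .$$ A function $\Phi$ is said to have Lyapunov parameter $d$ if, for all $\tau$ below some real number, $$\Phi(\tau)=-a+d\,e^{a\tau}+\sum_{l\ge2}h_l\,d^{\,l}e^{la\tau},\qquad h_1=1,\quad h_l=\frac{1}{a\,l^2(l-1)}\sum_{k=1}^{l-1}k\Bigl(\frac{(m-1)(l-k)}{m}-k\Bigr)h_kh_{l-k}\quad(l\ge 2).$$ The BVP has a unique solution $\Phi_m$, and $\Phi_m$ is strictly increasing on $\mathbb{R}_-$.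 Moreover: (i) For $m=1/3$: for every $\tau\le0$, $\Phi=\Phi_{1/3}(\tau)$ is the unique number in $(-a,0]$ with $$\tau=\frac{\sqrt3\,\pi}{6a}-\frac1{2a}\ln\frac{a+\sqrt{-a\Phi}-\Phi}{(\sqrt a-\sqrt{-\Phi})^2}-\frac{\sqrt3}{a}\arctan\frac{\sqrt a+2\sqrt{-\Phi}}{\sqrt{3a}} ;$$ further, with all integrals convergent, $$\Phi_{1/3}(0)=0,\qquad \Phi_{1/3}'(0)=\frac{a^2}2+\int_{-\infty}^0 s\,\Phi_{1/3}'(s)^2\,ds=0,\qquad \Phi_{1/3}''(0)=-\int_{-\infty}^0\Phi_{1/3}'(s)^2\,ds=-\frac{2a^3}{9};$$ the Lyapunov parameter is $d=2\sqrt3\,a\,e^{\sqrt3\pi/6}$; and there is an inflection point $\tau_{\rm in}<0$, with $\Phi_{1/3}''>0$ on $(-\infty,\tau_{\rm in})$, $\Phi_{1/3}''(\tau_{\rm in})=0$ and $\Phi_{1/3}''<0$ on $(\tau_{\rm in},0]$, which is the only $\tau\le0$ with $\Phi_{1/3}(\tau)\Phi_{1/3}'(\tau)=-\int_{-\infty}^{\tau}\Phi_{1/3}'(s)^2\,ds$.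 (ii) For $m=1/2$: $\Phi_{1/2}(\tau)=a\tanh(a\tau/2)$, which solves the differential equation on all of $\mathbb{R}$; $\Phi_{1/2}(0)=\Phi_{1/2}''(0)=0$, $\Phi_{1/2}'(0)=a^2/2$, the Lyapunov parameter is $d=2a$, and $\Phi_{1/2}$ is convex on $\mathbb{R}_-$. (iii) For $m=\infty$: $\Phi_\infty(\tau)=a(e^{a\tau}-1)$, which solves the differential equation on all of $\mathbb{R}$; $\Phi_\infty(0)=0$, $\Phi_\infty'(0)=a^2$, $\Phi_\infty''(0)=a^3$, the Lyapunov parameter is $d=a$, and $\Phi_\infty$ is convex on $\mathbb{R}_-$. Consequently, for each of these $m$ and every $b\ne0$ there is no solution on the whole line $\mathbb{R}$ of the same differential equation with the same conditions at $-\infty$ and at $0$ and with $\lim_{\tau\to\infty}\Phi(\tau)/\tau^m=b$ (for $m=\infty$: with $\lim_{\tau\to\infty}\Phi(\tau)/\tau^k=b$ for some real exponent $k$). Finally, $\Phi_{1/3}$ extends to a solution of the differential equation on $(-\infty,\tau_p)$, $\tau_p=2\pi\sqrt3/(3a)$, which tends to $-\infty$ as $\tau\to\tau_p-0$, and it does not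 extend to a solution on $(-\infty,T)$ for any $T>\tau_p$; in particular it does not exist globally on $\mathbb{R}$. -/

import Mathlib

open Set Filter Topology MeasureTheory

noncomputable section

namespace MixingLayer

/-- The coefficient `(m - 1) / m`, with its limit value `1` for `m = ∞`. -/
def coeffA : WithTop ℝ → ℝ
  | none => 1
  | some m => (m - 1) / m

/-- The coefficient `(2 m - 1) / m`, with its limit value `2` for `m = ∞`. -/
def coeffB : WithTop ℝ → ℝ
  | none => 2
  | some m => (2 * m - 1) / m

/-- `Φ` is a classical solution on the set `S` of `(Φ'' + Φ Φ')' = ((2 m - 1) / m) (Φ')²`.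
Derivatives are taken relative to `S`; on `(-∞, 0]` this is the left derivative at `0`. -/
structure SolvesODE (m : WithTop ℝ) (S : Set ℝ) (Φ : ℝ → ℝ) : Prop where
  contDiffOn : ContDiffOn ℝ 3 Φ S
  eqn : ∀ τ ∈ S,
    derivWithin (fun s => iteratedDerivWithin 2 Φ S s + Φ s * derivWithin Φ S s) S τ
      = coeffB m * (derivWithin Φ S τ) ^ 2

/-- `exp (-ε τ) * (Φ + a, Φ', Φ'') → (0, 0, 0)` as `τ → -∞`, for every `0 < ε < a`. -/
def LimitAtBot (a : ℝ) (S : Set ℝ) (Φ : ℝ → ℝ) : Prop :=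
  ∀ ε : ℝ, 0 < ε → ε < a →
    Tendsto (fun τ => Real.exp (-ε * τ) * (Φ τ + a)) atBot (𝓝 0) ∧
    Tendsto (fun τ => Real.exp (-ε * τ) * derivWithin Φ S τ) atBot (𝓝 0) ∧
    Tendsto (fun τ => Real.exp (-ε * τ) * iteratedDerivWithin 2 Φ S τ) atBot (𝓝 0)

/-- Solutions of the singular boundary value problem on `(-∞, 0]`. -/
structure IsBVPSolution (m : WithTop ℝ) (a : ℝ) (Φ : ℝ → ℝ) : Prop where
  ode : SolvesODE m (Iic 0) Φ
  lim : LimitAtBot a (Iic 0) Φ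
  zero : Φ 0 = 0

/-- `Φ(τ) / τ ^ m → b` as `τ → ∞`. For `m = ∞` the function is required to behave
like `b τ ^ k` for some real exponent `k`. -/
def PowerGrowth (b : ℝ) (Φ : ℝ → ℝ) : WithTop ℝ → Prop
  | none => ∃ k : ℝ, Tendsto (fun τ : ℝ => Φ τ / τ ^ k) atTop (𝓝 b)
  | some m => Tendsto (fun τ : ℝ => Φ τ / τ ^ m) atTop (𝓝 b)

/-- Solutions of the singular problem on the whole real line. -/
structure IsIBVPSolution (m : WithTop ℝ) (a b : ℝ) (Φ : ℝ → ℝ) : Prop where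
  ode : SolvesODE m univ Φ
  lim : LimitAtBot a univ Φ
  zero : Φ 0 = 0
  growth : PowerGrowth b Φ m

/-- The coefficients `h_l` of the exponential Lyapunov series: `h_1 = 1` and, for `l ≥ 2`,
`h_l = (∑_{k=1}^{l-1} k ((m-1)(l-k)/m - k) h_k h_{l-k}) / (a l² (l-1))`. Below `l = n + 2`, and
the summation index is `k + 1`; the value at `l = 0` is not used. -/
def lyapunovCoeff (m : WithTop ℝ) (a : ℝ) : ℕ → ℝ
  | 0 => 0
  | 1 => 1
  | n + 2 =>
    (∑ k : Fin (n + 1),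
      ((k : ℝ) + 1) * (coeffA m * (((n : ℝ) + 2) - ((k : ℝ) + 1)) - ((k : ℝ) + 1))
        * lyapunovCoeff m a ((k : ℕ) + 1) * lyapunovCoeff m a (n + 1 - (k : ℕ)))
      / (a * ((n : ℝ) + 2) ^ 2 * ((n : ℝ) + 1))
termination_by l => l
decreasing_by all_goals omega

/-- `Φ(τ) = -a + d e^{aτ} + ∑_{l ≥ 2} h_l d^l e^{l a τ}` for all `τ` below some real number. -/
def HasLyapunovSeries (m : WithTop ℝ) (a d : ℝ) (Φ : ℝ → ℝ) : Prop :=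
  ∃ τ₀ : ℝ, ∀ τ ≤ τ₀,
    HasSum (fun l : ℕ =>
        lyapunovCoeff m a (l + 2) * d ^ (l + 2) * Real.exp (((l : ℝ) + 2) * a * τ))
      (Φ τ - (-a + d * Real.exp (a * τ)))

/-- The function of `y ∈ (-a, 0]` in the implicit formula `τ = tauThird a (Φ τ)`, `m = 1/3`. -/
def tauThird (a y : ℝ) : ℝ :=
  √3 * Real.pi / (6 * a)
    - 1 / (2 * a) * Real.log ((a + √(-a * y) - y) / (√a - √(-y)) ^ 2)
    - √3 / a * Real.arctan ((√a + 2 * √(-y)) / √(3 * a))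

end MixingLayer

end

/-!
For `m = 1/3, 1/2, ∞` the equation reads `f''' = c (f')² - f f''` with `c = -2, -1, 1`, and in
each case it integrates far enough to reduce the boundary value problem to an explicit function.
Uniqueness for the third-order initial value problem (`IsSolutionJet.eqOn_Icc`) then only has to
be combined with uniqueness near `-∞`.

* `m = 1/2`: `f'' + f f'` and `f' + f² / 2` are constant, so `f(0) = 0` determines the whole jet
  at `0` (`IsSolutionJet.eqOn_tanh`).
* `m = ∞`: with `z = f + a`, the functions `y = z' - a z` and `w = y'` satisfy a homogeneous
  linear system with small coefficients near `-∞`, and decay too fast not to vanish; so `z` is a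
  multiple of `e^{aτ}` (`IsSolutionJet.exists_eqOn_exp`).
* `m = 1/3`: `f f'' - (f')² / 2 + f² f' = 0`. For `f = -u²` and `a = α²` this says `u'' = u² u'`,
  hence `u' = (u³ - α³) / 3`, whose solutions are the translates of the inverse `thirdProfile α`
  of the elementary function `thirdTime α`. That `-a < f < 0` near `-∞`, which the substitution
  needs, comes from `f'' + f f' = -∫ (f')² ≤ 0` (`IsSolutionJet.exists_deriv_nonneg_third`). The
  translates continue through `u = 0` to `u → -∞` at a finite time, which gives the blow-up, and
  as nothing can be continued past it (`IsSolutionJet.eqOn_thirdProfile_shift`), also the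
  nonexistence on `ℝ`. For the other two values of `m` the explicit solution has the wrong growth
  at `+∞`.

The Lyapunov coefficients are explicit for `m = 1/2` and `m = ∞`. For `m = 1/3` they satisfy
`|h_l| ≤ a^{1-l}`, so the series converges near `-∞`, and by the recursion it is a solution there.
It is therefore a translate of the explicit solution, and comparing the coefficients of `e^{aτ}`
shows that the translation is by `0` exactly for the stated value of `d`
(`hasLyapunovSeries_third`).
-/

namespace MixingLayer

/-! ### Solutions as jets, and uniqueness for the third-order equation -/

/-- `(f, f₁, f₂)` is the 2-jet on `S` of a solution `f` of `f''' = c (f')² - f f''`, the expanded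
form of `(f'' + f f')' = (c + 1) (f')²`. Derivatives are relative to `S`. Working with jets keeps
`derivWithin` out of the estimates, and lets the same jet serve on every smaller set. -/
structure IsSolutionJet (c : ℝ) (S : Set ℝ) (f f₁ f₂ : ℝ → ℝ) : Prop where
  deriv₀ : ∀ τ ∈ S, HasDerivWithinAt f (f₁ τ) S τ
  deriv₁ : ∀ τ ∈ S, HasDerivWithinAt f₁ (f₂ τ) S τ
  deriv₂ : ∀ τ ∈ S, HasDerivWithinAt f₂ (c * f₁ τ ^ 2 - f τ * f₂ τ) S τ

namespace IsSolutionJet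

variable {c : ℝ} {S : Set ℝ} {f f₁ f₂ : ℝ → ℝ}

theorem mono (h : IsSolutionJet c S f f₁ f₂) {S' : Set ℝ} (hS : S' ⊆ S) :
    IsSolutionJet c S' f f₁ f₂ :=
  ⟨fun τ hτ => (h.deriv₀ τ (hS hτ)).mono hS, fun τ hτ => (h.deriv₁ τ (hS hτ)).mono hS,
    fun τ hτ => (h.deriv₂ τ (hS hτ)).mono hS⟩

theorem continuousOn₀ (h : IsSolutionJet c S f f₁ f₂) : ContinuousOn f S :=
  fun τ hτ => (h.deriv₀ τ hτ).continuousWithinAt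

theorem continuousOn₁ (h : IsSolutionJet c S f f₁ f₂) : ContinuousOn f₁ S :=
  fun τ hτ => (h.deriv₁ τ hτ).continuousWithinAt

theorem continuousOn₂ (h : IsSolutionJet c S f f₁ f₂) : ContinuousOn f₂ S :=
  fun τ hτ => (h.deriv₂ τ hτ).continuousWithinAt

theorem derivWithin_eq (h : IsSolutionJet c S f f₁ f₂) (hS : UniqueDiffOn ℝ S) {τ : ℝ}
    (hτ : τ ∈ S) : derivWithin f S τ = f₁ τ :=
  (h.deriv₀ τ hτ).derivWithin (hS τ hτ)

theorem iteratedDerivWithin_two_eq (h : IsSolutionJet c S f f₁ f₂) (hS : UniqueDiffOn ℝ S)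
    {τ : ℝ} (hτ : τ ∈ S) : iteratedDerivWithin 2 f S τ = f₂ τ := by
  rw [iteratedDerivWithin_succ, iteratedDerivWithin_one]
  exact ((h.deriv₁ τ hτ).congr (fun s hs => h.derivWithin_eq hS hs)
    (h.derivWithin_eq hS hτ)).derivWithin (hS τ hτ)

theorem solvesODE (h : IsSolutionJet c S f f₁ f₂) (hS : UniqueDiffOn ℝ S) {m : WithTop ℝ}
    (hm : coeffB m = c + 1) : SolvesODE m S f := by
  constructor
  · have h₃ : ContinuousOn (fun τ => c * f₁ τ ^ 2 - f τ * f₂ τ) S :=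
      (continuousOn_const.mul (h.continuousOn₁.pow 2)).sub (h.continuousOn₀.mul h.continuousOn₂)
    have c₂ : ContDiffOn ℝ 1 f₂ S :=
      (contDiffOn_succ_iff_derivWithin (n := 0) hS).2
        ⟨fun τ hτ => (h.deriv₂ τ hτ).differentiableWithinAt, by simp, contDiffOn_zero.2
          (h₃.congr fun τ hτ => (h.deriv₂ τ hτ).derivWithin (hS τ hτ))⟩
    have c₁ : ContDiffOn ℝ 2 f₁ S :=
      (contDiffOn_succ_iff_derivWithin (n := 1) hS).2
        ⟨fun τ hτ => (h.deriv₁ τ hτ).differentiableWithinAt, by simp,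
          c₂.congr fun τ hτ => (h.deriv₁ τ hτ).derivWithin (hS τ hτ)⟩
    exact (contDiffOn_succ_iff_derivWithin (n := 2) hS).2
        ⟨fun τ hτ => (h.deriv₀ τ hτ).differentiableWithinAt, by simp,
          c₁.congr fun τ hτ => (h.deriv₀ τ hτ).derivWithin (hS τ hτ)⟩
  · intro τ hτ
    rw [h.derivWithin_eq hS hτ, hm]
    have h1 := ((h.deriv₂ τ hτ).add ((h.deriv₀ τ hτ).mul (h.deriv₁ τ hτ)))
    have h2 : HasDerivWithinAt
        (fun s => iteratedDerivWithin 2 f S s + f s * derivWithin f S s)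
        (c * f₁ τ ^ 2 - f τ * f₂ τ + (f₁ τ * f₁ τ + f τ * f₂ τ)) S τ :=
      h1.congr (fun s hs => by
          simp [h.iteratedDerivWithin_two_eq hS hs, h.derivWithin_eq hS hs])
        (by simp [h.iteratedDerivWithin_two_eq hS hτ, h.derivWithin_eq hS hτ])
    rw [h2.derivWithin (hS τ hτ)]
    ring

end IsSolutionJet

theorem SolvesODE.isSolutionJet {m : WithTop ℝ} {S : Set ℝ} {Φ : ℝ → ℝ} (h : SolvesODE m S Φ)
    (hS : UniqueDiffOn ℝ S) {c : ℝ} (hm : coeffB m = c + 1) :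
    IsSolutionJet c S Φ (derivWithin Φ S) (iteratedDerivWithin 2 Φ S) := by
  have d₀ : ∀ τ ∈ S, HasDerivWithinAt Φ (derivWithin Φ S τ) S τ := fun τ hτ =>
    (h.contDiffOn.differentiableOn (by norm_num) τ hτ).hasDerivWithinAt
  have d₁ : ∀ τ ∈ S, HasDerivWithinAt (derivWithin Φ S) (iteratedDerivWithin 2 Φ S τ) S τ := by
    intro τ hτ
    have h1 := (h.contDiffOn.differentiableOn_iteratedDerivWithin (m := 1) (by norm_num) hS
      τ hτ).hasDerivWithinAt
    rw [iteratedDerivWithin_succ]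
    rwa [iteratedDerivWithin_one] at h1 ⊢
  refine ⟨d₀, d₁, fun τ hτ => ?_⟩
  have h2 := (h.contDiffOn.differentiableOn_iteratedDerivWithin (m := 2) (by norm_num) hS
      τ hτ).hasDerivWithinAt
  have h3 := (h2.add ((d₀ τ hτ).mul (d₁ τ hτ))).derivWithin (hS τ hτ)
  have h4 := h.eqn τ hτ
  rw [hm] at h4
  have h5 := h3.symm.trans h4
  have h6 : c * derivWithin Φ S τ ^ 2 - Φ τ * iteratedDerivWithin 2 Φ S τ
      = derivWithin (iteratedDerivWithin 2 Φ S) S τ := by linear_combination -h5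
  rw [h6]
  exact h2

theorem hasDerivAt_of_Iic {f : ℝ → ℝ} {d T τ : ℝ} (h : HasDerivWithinAt f d (Iic T) τ)
    (hτ : τ < T) : HasDerivAt f d τ :=
  h.hasDerivAt (Iic_mem_nhds hτ)

theorem antitoneOn_Iic_of_deriv_nonpos {g g' : ℝ → ℝ} {T : ℝ}
    (hg : ∀ τ ∈ Iic T, HasDerivWithinAt g (g' τ) (Iic T) τ) (hg' : ∀ τ ∈ Iic T, g' τ ≤ 0) :
    AntitoneOn g (Iic T) := by
  refine antitoneOn_of_hasDerivWithinAt_nonpos (f' := g') (convex_Iic T)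
    (fun τ hτ => (hg τ hτ).continuousWithinAt) (fun τ hτ => ?_)
    (fun τ hτ => hg' τ (interior_subset hτ))
  exact (hg τ (interior_subset hτ)).mono interior_subset

theorem eq_of_deriv_zero {g : ℝ → ℝ} {T : ℝ}
    (hg : ∀ τ ∈ Iic T, HasDerivWithinAt g 0 (Iic T) τ) : ∀ τ ∈ Iic T, g τ = g T := by
  have h1 : AntitoneOn g (Iic T) := antitoneOn_Iic_of_deriv_nonpos hg fun _ _ => le_rfl
  have h2 : AntitoneOn (-g) (Iic T) :=
    antitoneOn_Iic_of_deriv_nonpos (fun τ hτ => (hg τ hτ).neg) (fun _ _ => by simp)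
  intro τ hτ
  have h3 := h1 hτ self_mem_Iic hτ
  have h4 := h2 hτ self_mem_Iic hτ
  simp only [Pi.neg_apply] at h4
  linarith

theorem eq_of_tendsto_of_deriv_zero {g : ℝ → ℝ} {T l : ℝ}
    (hg : ∀ τ ∈ Iic T, HasDerivWithinAt g 0 (Iic T) τ) (hl : Tendsto g atBot (𝓝 l)) :
    ∀ τ ∈ Iic T, g τ = l := by
  have h1 := eq_of_deriv_zero hg
  have h2 : g T = l := tendsto_nhds_unique (tendsto_const_nhds.congr' (by
    filter_upwards [eventually_le_atBot T] with s hs using (h1 s hs).symm)) hl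
  exact fun τ hτ => (h1 τ hτ).trans h2

/-- A nonnegative function with `N' ≤ K N` and `e^{-Kτ} N → 0` at `-∞` vanishes: `e^{-Kτ} N` is
antitone. -/
theorem eq_zero_of_deriv_le_mul_of_tendsto {N N' : ℝ → ℝ} {K T : ℝ} (h0 : ∀ τ, 0 ≤ N τ)
    (hN : ∀ τ ∈ Iic T, HasDerivWithinAt N (N' τ) (Iic T) τ) (hK : ∀ τ ∈ Iic T, N' τ ≤ K * N τ)
    (hl : Tendsto (fun τ => Real.exp (-K * τ) * N τ) atBot (𝓝 0)) :
    ∀ τ ∈ Iic T, N τ = 0 := by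
  have hE : ∀ τ, HasDerivAt (fun τ => Real.exp (-K * τ)) (Real.exp (-K * τ) * (-K)) τ := fun τ => by
    simpa using ((hasDerivAt_id τ).const_mul (-K)).exp
  have h1 : AntitoneOn (fun τ => Real.exp (-K * τ) * N τ) (Iic T) := by
    refine antitoneOn_Iic_of_deriv_nonpos
      (fun τ hτ => (hE τ).hasDerivWithinAt.mul (hN τ hτ)) (fun τ hτ => ?_)
    have := mul_le_mul_of_nonneg_left (hK τ hτ) (Real.exp_pos (-K * τ)).le
    nlinarith
  intro τ hτ
  have h2 : Real.exp (-K * τ) * N τ ≤ 0 := by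
    refine ge_of_tendsto hl ?_
    filter_upwards [eventually_le_atBot τ] with s hs
    exact h1 (le_trans hs hτ : s ∈ Iic T) hτ hs
  have := Real.exp_pos (-K * τ)
  exact le_antisymm (by by_contra hc; push Not at hc; nlinarith [mul_pos this hc]) (h0 τ)

/-- A nonnegative function on a segment with `|N'| ≤ K N` that vanishes at one point is zero. -/
theorem eq_zero_of_abs_deriv_le_mul {N N' : ℝ → ℝ} {K p q t : ℝ} (h0 : ∀ τ, 0 ≤ N τ)
    (hN : ∀ τ ∈ Icc p q, HasDerivWithinAt N (N' τ) (Icc p q) τ)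
    (hK : ∀ τ ∈ Icc p q, |N' τ| ≤ K * N τ) (ht : t ∈ Icc p q) (hz : N t = 0) :
    ∀ τ ∈ Icc p q, N τ = 0 := by
  have hE : ∀ k τ, HasDerivAt (fun τ => Real.exp (k * τ)) (Real.exp (k * τ) * k) τ :=
    fun k τ => by simpa using ((hasDerivAt_id τ).const_mul k).exp
  have h1 : AntitoneOn (fun τ => Real.exp (-K * τ) * N τ) (Icc p q) := by
    refine antitoneOn_of_hasDerivWithinAt_nonpos
      (f' := fun τ => Real.exp (-K * τ) * (-K) * N τ + Real.exp (-K * τ) * N' τ) (convex_Icc p q)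
      (fun τ hτ => ((hE (-K) τ).continuousAt.continuousWithinAt.mul
        (hN τ hτ).continuousWithinAt)) (fun τ hτ => ?_) (fun τ hτ => ?_)
    · exact (((hE (-K) τ).hasDerivWithinAt.mul (hN τ (interior_subset hτ)))).mono interior_subset
    · have h2 := (abs_le.1 (hK τ (interior_subset hτ))).2
      have := mul_le_mul_of_nonneg_left h2 (Real.exp_pos (-K * τ)).le
      nlinarith
  have h2 : MonotoneOn (fun τ => Real.exp (K * τ) * N τ) (Icc p q) := by
    refine monotoneOn_of_hasDerivWithinAt_nonneg
      (f' := fun τ => Real.exp (K * τ) * K * N τ + Real.exp (K * τ) * N' τ) (convex_Icc p q)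
      (fun τ hτ => ((hE K τ).continuousAt.continuousWithinAt.mul
        (hN τ hτ).continuousWithinAt)) (fun τ hτ => ?_) (fun τ hτ => ?_)
    · exact (((hE K τ).hasDerivWithinAt.mul (hN τ (interior_subset hτ)))).mono interior_subset
    · have h2 := (abs_le.1 (hK τ (interior_subset hτ))).1
      have := mul_le_mul_of_nonneg_left h2 (Real.exp_pos (K * τ)).le
      nlinarith
  intro τ hτ
  have key : ∀ k, Real.exp (k * τ) * N τ ≤ 0 → N τ = 0 := fun k hk => by
    have := Real.exp_pos (k * τ)
    exact le_antisymm (by by_contra hc; push Not at hc; nlinarith [mul_pos this hc]) (h0 τ)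
  rcases le_total t τ with h | h
  · exact key (-K) (by simpa [hz] using h1 ht hτ h)
  · exact key K (by simpa [hz] using h2 hτ ht h)

namespace IsSolutionJet

variable {c : ℝ} {f f₁ f₂ g g₁ g₂ : ℝ → ℝ}

/-- Uniqueness for the initial value problem on a segment, with data at any of its points. -/
theorem eqOn_Icc {p q t : ℝ} (hf : IsSolutionJet c (Icc p q) f f₁ f₂)
    (hg : IsSolutionJet c (Icc p q) g g₁ g₂) (ht : t ∈ Icc p q) (h₀ : f t = g t)
    (h₁ : f₁ t = g₁ t) (h₂ : f₂ t = g₂ t) : EqOn f g (Icc p q) := by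
  obtain ⟨A, hA⟩ := isCompact_Icc.exists_bound_of_continuousOn hf.continuousOn₂
  obtain ⟨B, hB⟩ := isCompact_Icc.exists_bound_of_continuousOn hg.continuousOn₀
  obtain ⟨C, hC⟩ := isCompact_Icc.exists_bound_of_continuousOn
    (continuousOn_const (c := c) |>.mul (hf.continuousOn₁.add hg.continuousOn₁))
  have hN : ∀ τ ∈ Icc p q, HasDerivWithinAt
      (fun τ => (f τ - g τ) ^ 2 + (f₁ τ - g₁ τ) ^ 2 + (f₂ τ - g₂ τ) ^ 2)
      (2 * (f τ - g τ) * (f₁ τ - g₁ τ) + 2 * (f₁ τ - g₁ τ) * (f₂ τ - g₂ τ)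
        + 2 * (f₂ τ - g₂ τ) * (c * (f₁ τ + g₁ τ) * (f₁ τ - g₁ τ)
          - f₂ τ * (f τ - g τ) - g τ * (f₂ τ - g₂ τ))) (Icc p q) τ := by
    intro τ hτ
    refine (((((hf.deriv₀ τ hτ).sub (hg.deriv₀ τ hτ)).pow 2).add
      (((hf.deriv₁ τ hτ).sub (hg.deriv₁ τ hτ)).pow 2)).add
      (((hf.deriv₂ τ hτ).sub (hg.deriv₂ τ hτ)).pow 2)).congr_deriv ?_
    simp only [Pi.sub_apply]
    push_cast
    ring
  have hz := eq_zero_of_abs_deriv_le_mul (K := 2 + A + 2 * B + C) (fun τ => by positivity) hN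
    (fun τ hτ => ?_) ht (by simp [h₀, h₁, h₂])
  · intro τ hτ
    have := hz τ hτ
    nlinarith [sq_nonneg (f τ - g τ), sq_nonneg (f₁ τ - g₁ τ), sq_nonneg (f₂ τ - g₂ τ)]
  · have a1 := hA τ hτ
    have b1 := hB τ hτ
    have c1 := hC τ hτ
    rw [Real.norm_eq_abs] at a1 b1 c1
    generalize f τ - g τ = x
    generalize f₁ τ - g₁ τ = y
    generalize f₂ τ - g₂ τ = z
    set k := c * (f₁ τ + g₁ τ)
    have am : ∀ k K x y : ℝ, |k| ≤ K → |2 * k * (x * y)| ≤ K * (x ^ 2 + y ^ 2) := by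
      intro k K x y hk
      have : |2 * k * (x * y)| = |k| * |2 * x * y| := by rw [← abs_mul]; ring_nf
      rw [this]
      refine mul_le_mul hk ?_ (abs_nonneg _) (le_trans (abs_nonneg _) hk)
      exact abs_le.2 ⟨by nlinarith [sq_nonneg (x + y)], by nlinarith [sq_nonneg (x - y)]⟩
    have e1 := abs_le.1 (am 1 1 x y (by simp))
    have e2 := abs_le.1 (am 1 1 y z (by simp))
    have e3 := abs_le.1 (am k C y z c1)
    have e4 := abs_le.1 (am (f₂ τ) A x z a1)
    have e5 := abs_le.1 (am (g τ) B z z b1)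
    have hA0 : 0 ≤ A := le_trans (abs_nonneg _) a1
    have hB0 : 0 ≤ B := le_trans (abs_nonneg _) b1
    have hC0 : 0 ≤ C := le_trans (abs_nonneg _) c1
    have i1 := mul_nonneg hA0 (sq_nonneg y)
    have i2 := mul_nonneg hC0 (sq_nonneg x)
    have i3 := mul_nonneg hB0 (sq_nonneg x)
    have i4 := mul_nonneg hB0 (sq_nonneg y)
    have i5 := sq_nonneg x
    have i6 := sq_nonneg y
    have i7 := sq_nonneg z
    refine abs_le.2 ⟨by linarith [e1.1, e2.1, e3.1, e4.2, e5.2],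
      by linarith [e1.2, e2.2, e3.2, e4.1, e5.1]⟩

/-- Jets of the same function on a left half-line agree. -/
theorem jet_eq_of_eqOn_Iic {t : ℝ} (hf : IsSolutionJet c (Iic t) f f₁ f₂)
    (hg : IsSolutionJet c (Iic t) g g₁ g₂) (h : EqOn f g (Iic t)) :
    EqOn f₁ g₁ (Iic t) ∧ EqOn f₂ g₂ (Iic t) := by
  have hu := uniqueDiffOn_Iic t
  have e₁ : EqOn f₁ g₁ (Iic t) := fun τ hτ =>
    (hu τ hτ).eq_deriv (𝕜 := ℝ) _ (hf.deriv₀ τ hτ) ((hg.deriv₀ τ hτ).congr h (h hτ))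
  exact ⟨e₁, fun τ hτ =>
    (hu τ hτ).eq_deriv (𝕜 := ℝ) _ (hf.deriv₁ τ hτ) ((hg.deriv₁ τ hτ).congr e₁ (e₁ hτ))⟩

/-- Solutions that agree near `-∞` agree as long as both exist. -/
theorem eqOn_Iic {t T : ℝ} (hf : IsSolutionJet c (Iic T) f f₁ f₂)
    (hg : IsSolutionJet c (Iic T) g g₁ g₂) (htT : t ≤ T) (h : EqOn f g (Iic t)) :
    EqOn f g (Iic T) := by
  obtain ⟨h₁, h₂⟩ := (hf.mono (Iic_subset_Iic.2 htT)).jet_eq_of_eqOn_Iic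
    (hg.mono (Iic_subset_Iic.2 htT)) h
  intro τ hτ
  rcases le_total τ t with hτt | hτt
  · exact h hτt
  · exact (hf.mono (fun x hx => hx.2)).eqOn_Icc (hg.mono (fun x hx => hx.2)) (p := t) (q := T)
      (left_mem_Icc.2 htT) (h self_mem_Iic) (h₁ self_mem_Iic) (h₂ self_mem_Iic) ⟨hτt, hτ⟩

end IsSolutionJet

/-! ### Exponential decay at `-∞` -/

/-- `e^{-ετ} g(τ) → 0` as `τ → -∞`, for every `0 < ε < a`. -/
def ExpDecay (a : ℝ) (g : ℝ → ℝ) : Prop :=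
  ∀ ε : ℝ, 0 < ε → ε < a → Tendsto (fun τ => Real.exp (-ε * τ) * g τ) atBot (𝓝 0)

namespace ExpDecay

variable {a : ℝ} {g h : ℝ → ℝ}

theorem mul_tendsto (hg : ExpDecay a g) {l : ℝ} (hh : Tendsto h atBot (𝓝 l)) :
    ExpDecay a (fun τ => g τ * h τ) := fun ε h1 h2 => by
  simpa [mul_assoc] using (hg ε h1 h2).mul hh

theorem add (hg : ExpDecay a g) (hh : ExpDecay a h) : ExpDecay a (fun τ => g τ + h τ) :=
  fun ε h1 h2 => by simpa [mul_add] using (hg ε h1 h2).add (hh ε h1 h2)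

theorem const_mul (hg : ExpDecay a g) (k : ℝ) : ExpDecay a (fun τ => k * g τ) :=
  fun ε h1 h2 => by simpa [mul_left_comm] using (hg ε h1 h2).const_mul k

theorem congr' (hg : ExpDecay a g) (h' : g =ᶠ[atBot] h) : ExpDecay a h := fun ε h1 h2 =>
  (hg ε h1 h2).congr' (by filter_upwards [h'] with τ hτ; rw [hτ])

theorem tendsto_zero (ha : 0 < a) (hg : ExpDecay a g) : Tendsto g atBot (𝓝 0) := by
  have h1 : Tendsto (fun τ : ℝ => Real.exp (a / 2 * τ)) atBot (𝓝 0) :=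
    Real.tendsto_exp_atBot.comp (tendsto_id.const_mul_atBot (by positivity))
  have h2 := h1.mul (hg (a / 2) (by positivity) (by linarith))
  rw [mul_zero] at h2
  refine h2.congr fun τ => ?_
  rw [← mul_assoc, ← Real.exp_add]
  simp

theorem id_mul_tendsto_zero (ha : 0 < a) (hg : ExpDecay a g) :
    Tendsto (fun τ => τ * g τ) atBot (𝓝 0) := by
  have h1 : Tendsto (fun τ : ℝ => τ * Real.exp (a / 2 * τ)) atBot (𝓝 0) := by
    have h := (Real.tendsto_pow_mul_exp_neg_atTop_nhds_zero 1).comp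
      (tendsto_neg_atBot_atTop.const_mul_atTop (by positivity : 0 < a / 2))
    have h' := h.const_mul (-(2 / a))
    rw [mul_zero] at h'
    refine h'.congr fun τ => ?_
    simp only [Function.comp]
    field_simp
  have h2 := h1.mul (hg (a / 2) (by positivity) (by linarith))
  rw [mul_zero] at h2
  refine h2.congr fun τ => ?_
  have : Real.exp (a / 2 * τ) * Real.exp (-(a / 2) * τ) = 1 := by
    rw [← Real.exp_add]; simp
  linear_combination (τ * g τ) * this

theorem of_le_exp {C T : ℝ} (hg : ∀ τ ≤ T, |g τ| ≤ C * Real.exp (a * τ)) : ExpDecay a g := by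
  intro ε _ h2
  have h1 : Tendsto (fun τ : ℝ => C * Real.exp ((a - ε) * τ)) atBot (𝓝 0) := by
    simpa using (Real.tendsto_exp_atBot.comp
      (tendsto_id.const_mul_atBot (by linarith : 0 < a - ε))).const_mul C
  refine squeeze_zero_norm' ?_ h1
  filter_upwards [eventually_le_atBot T] with τ hτ
  rw [norm_mul, Real.norm_eq_abs, Real.abs_exp, Real.norm_eq_abs]
  calc _ ≤ Real.exp (-ε * τ) * (C * Real.exp (a * τ)) :=
        mul_le_mul_of_nonneg_left (hg τ hτ) (Real.exp_pos _).le
    _ = _ := by rw [mul_left_comm, ← Real.exp_add]; ring_nf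

end ExpDecay

theorem limitAtBot_iff {a : ℝ} {S : Set ℝ} {Φ : ℝ → ℝ} :
    LimitAtBot a S Φ ↔ ExpDecay a (fun τ => Φ τ + a) ∧ ExpDecay a (derivWithin Φ S) ∧
      ExpDecay a (iteratedDerivWithin 2 Φ S) :=
  ⟨fun h => ⟨fun ε h1 h2 => (h ε h1 h2).1, fun ε h1 h2 => (h ε h1 h2).2.1,
    fun ε h1 h2 => (h ε h1 h2).2.2⟩,
    fun h ε h1 h2 => ⟨h.1 ε h1 h2, h.2.1 ε h1 h2, h.2.2 ε h1 h2⟩⟩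

/-! ### The case `m = 1/2` -/

theorem tanh_isSolutionJet (a : ℝ) (S : Set ℝ) :
    IsSolutionJet (-1) S (fun τ => a * Real.tanh (a * τ / 2))
      (fun τ => (a ^ 2 - (a * Real.tanh (a * τ / 2)) ^ 2) / 2)
      (fun τ => -(a * Real.tanh (a * τ / 2))
        * ((a ^ 2 - (a * Real.tanh (a * τ / 2)) ^ 2) / 2)) := by
  have h : ∀ τ, HasDerivAt (fun τ => a * Real.tanh (a * τ / 2))
      ((a ^ 2 - (a * Real.tanh (a * τ / 2)) ^ 2) / 2) τ := fun τ => by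
    have h1 : HasDerivAt (fun τ : ℝ => a * τ / 2) (a / 2) τ := by
      simpa using ((hasDerivAt_id τ).const_mul a).div_const 2
    have hc : Real.cosh (a * τ / 2) ≠ 0 := (Real.cosh_pos _).ne'
    have h2 := h1.sinh.div h1.cosh hc
    have h3 := (h2.const_mul a).congr_of_eventuallyEq
      (f₁ := fun τ => a * Real.tanh (a * τ / 2))
      (Eventually.of_forall fun s => by simp [Real.tanh_eq_sinh_div_cosh])
    refine h3.congr_deriv ?_
    simp only [Real.tanh_eq_sinh_div_cosh]
    field_simp
  have h₁ : ∀ τ, HasDerivAt (fun τ => (a ^ 2 - (a * Real.tanh (a * τ / 2)) ^ 2) / 2)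
      (-(a * Real.tanh (a * τ / 2))
        * ((a ^ 2 - (a * Real.tanh (a * τ / 2)) ^ 2) / 2)) τ := fun τ => by
    refine ((((h τ).pow 2).const_sub (a ^ 2)).div_const 2).congr_deriv ?_
    push_cast
    ring
  refine ⟨fun τ _ => (h τ).hasDerivWithinAt, fun τ _ => (h₁ τ).hasDerivWithinAt, fun τ _ => ?_⟩
  refine (((h τ).neg.mul (h₁ τ)).congr_deriv ?_).hasDerivWithinAt
  simp only [Pi.neg_apply]
  ring

/-- For `m = 1/2` the equation integrates twice, to `f' + f² / 2 = a² / 2`, which turns the boundary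
condition at `0` into an initial condition for the full jet. -/
theorem IsSolutionJet.eqOn_tanh {a T : ℝ} {f f₁ f₂ : ℝ → ℝ} (hT : 0 ≤ T)
    (h : IsSolutionJet (-1) (Iic T) f f₁ f₂) (l₀ : Tendsto f atBot (𝓝 (-a)))
    (l₁ : Tendsto f₁ atBot (𝓝 0)) (l₂ : Tendsto f₂ atBot (𝓝 0)) (h0 : f 0 = 0) :
    EqOn f (fun τ => a * Real.tanh (a * τ / 2)) (Iic T) := by
  have e₁ : ∀ τ ∈ Iic T, f₂ τ + f τ * f₁ τ = 0 := by
    refine eq_of_tendsto_of_deriv_zero (fun τ hτ => ?_) (by simpa using l₂.add (l₀.mul l₁))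
    refine ((h.deriv₂ τ hτ).add ((h.deriv₀ τ hτ).mul (h.deriv₁ τ hτ))).congr_deriv ?_
    ring
  have e₂ : ∀ τ ∈ Iic T, f₁ τ + f τ ^ 2 / 2 = a ^ 2 / 2 := by
    refine eq_of_tendsto_of_deriv_zero (fun τ hτ => ?_)
      (by simpa using l₁.add ((l₀.pow 2).div_const 2))
    refine ((h.deriv₁ τ hτ).add (((h.deriv₀ τ hτ).pow 2).div_const 2)).congr_deriv ?_
    have := e₁ τ hτ
    push_cast
    linear_combination this
  have f₁0 := e₂ 0 hT
  have f₂0 := e₁ 0 hT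
  rw [h0] at f₁0 f₂0
  intro τ hτ
  refine (h.mono fun x hx => hx.2).eqOn_Icc (p := min τ 0) (q := T) (t := 0)
    (tanh_isSolutionJet a _) ⟨min_le_right _ _, hT⟩ (by simp [h0]) ?_ ?_ ⟨min_le_left _ _, hτ⟩
  · simp only [mul_zero, zero_div, Real.tanh_zero]
    linarith
  · simp only [mul_zero, zero_div, Real.tanh_zero]
    linarith

theorem expDecay_tanh_add {a : ℝ} (ha : 0 < a) :
    ExpDecay a (fun τ => a * Real.tanh (a * τ / 2) + a) := by
  refine ExpDecay.of_le_exp (C := 2 * a) (T := 0) fun τ _ => ?_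
  have hE := Real.exp_pos (a * τ)
  have h1 : a * Real.tanh (a * τ / 2) + a = 2 * a * Real.exp (a * τ) / (Real.exp (a * τ) + 1) := by
    have h2 : Real.exp (a * τ) = Real.exp (a * τ / 2) * Real.exp (a * τ / 2) := by
      rw [← Real.exp_add]; ring_nf
    rw [Real.tanh_eq, Real.exp_neg, h2]
    have := Real.exp_pos (a * τ / 2)
    field_simp
    ring
  rw [h1, abs_of_pos (by positivity)]
  exact div_le_self (by positivity) (by linarith)

/-! ### The case `m = ∞` -/

theorem exp_isSolutionJet (a d : ℝ) (S : Set ℝ) :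
    IsSolutionJet 1 S (fun τ => -a + d * Real.exp (a * τ))
      (fun τ => a * d * Real.exp (a * τ)) (fun τ => a ^ 2 * d * Real.exp (a * τ)) := by
  have hE : ∀ τ, HasDerivAt (fun τ => Real.exp (a * τ)) (Real.exp (a * τ) * a) τ := fun τ => by
    simpa using ((hasDerivAt_id τ).const_mul a).exp
  refine ⟨fun τ _ => ?_, fun τ _ => ?_, fun τ _ => ?_⟩
  · exact ((((hE τ).const_mul d).const_add (-a)).congr_deriv (by ring)).hasDerivWithinAt
  · exact (((hE τ).const_mul (a * d)).congr_deriv (by ring)).hasDerivWithinAt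
  · exact (((hE τ).const_mul (a ^ 2 * d)).congr_deriv (by ring)).hasDerivWithinAt

/-- For `m = ∞` the decaying solutions are exactly the curves `-a + d e^{aτ}`. With `z = f + a`, the
pair `y = z' - a z`, `w = z'' - a z'` satisfies the linear system `y' = w`, `w' = z' y - z w`, whose
coefficients are small near `-∞`; as `y` and `w` decay faster than `e^{aτ/2}`, they vanish. -/
theorem IsSolutionJet.exists_eqOn_exp {a T : ℝ} (ha : 0 < a) {f f₁ f₂ : ℝ → ℝ}
    (h : IsSolutionJet 1 (Iic T) f f₁ f₂) (l₀ : ExpDecay a (fun τ => f τ + a))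
    (l₁ : ExpDecay a f₁) (l₂ : ExpDecay a f₂) :
    ∃ d, EqOn f (fun τ => -a + d * Real.exp (a * τ)) (Iic T) := by
  have hy := l₁.add (l₀.const_mul (-a))
  have hw := l₂.add (l₁.const_mul (-a))
  have hev : ∀ᶠ τ in atBot, |f τ + a| < a / 8 ∧ |f₁ τ| < a ^ 2 / 16 := by
    have t₀ := (l₀.tendsto_zero ha).abs
    have t₁ := (l₁.tendsto_zero ha).abs
    rw [abs_zero] at t₀ t₁
    exact (t₀.eventually (gt_mem_nhds (by positivity))).and
      (t₁.eventually (gt_mem_nhds (by positivity)))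
  obtain ⟨t', ht'⟩ := eventually_atBot.1 hev
  set t := min t' T with ht
  have htT : t ≤ T := min_le_right _ _
  have hj := h.mono (Iic_subset_Iic.2 htT)
  -- The weight `(a / 4)²` balances the term `y' = w`, which is not small.
  have hz := eq_zero_of_deriv_le_mul_of_tendsto (K := a) (T := t)
    (N := fun τ => (a / 4) ^ 2 * (f₁ τ + -a * (f τ + a)) ^ 2 + (f₂ τ + -a * f₁ τ) ^ 2)
    (N' := fun τ => 2 * (a / 4) ^ 2 * (f₁ τ + -a * (f τ + a)) * (f₂ τ + -a * f₁ τ)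
      + 2 * (f₂ τ + -a * f₁ τ) * (f₁ τ * (f₁ τ + -a * (f τ + a))
        - (f τ + a) * (f₂ τ + -a * f₁ τ)))
    (fun τ => by positivity) (fun τ hτ => ?_) (fun τ hτ => ?_) ?_
  · have hy0 : ∀ τ ∈ Iic t, f₁ τ = a * (f τ + a) := fun τ hτ => by
      have h1 := hz τ hτ
      have h2 := sq_nonneg (f₂ τ + -a * f₁ τ)
      have h3 : (f₁ τ + -a * (f τ + a)) ^ 2 = 0 := by
        have : 0 < (a / 4) ^ 2 := by positivity
        have h4 := sq_nonneg (f₁ τ + -a * (f τ + a))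
        by_contra hne
        have := mul_pos this (lt_of_le_of_ne h4 (Ne.symm hne))
        linarith
      have := pow_eq_zero_iff (two_ne_zero) |>.1 h3
      linarith
    have hE : ∀ τ, HasDerivAt (fun τ => Real.exp (-a * τ)) (Real.exp (-a * τ) * (-a)) τ :=
      fun τ => by simpa using ((hasDerivAt_id τ).const_mul (-a)).exp
    have hd : ∀ τ ∈ Iic t, HasDerivWithinAt (fun τ => (f τ + a) * Real.exp (-a * τ)) 0 (Iic t) τ :=
      fun τ hτ => by
        refine (((hj.deriv₀ τ hτ).add_const a).mul (hE τ).hasDerivWithinAt).congr_deriv ?_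
        rw [hy0 τ hτ]
        ring
    refine ⟨(f t + a) * Real.exp (-a * t), h.eqOn_Iic (exp_isSolutionJet a _ _) htT ?_⟩
    intro τ hτ
    have hconst : (f τ + a) * Real.exp (-a * τ) = (f t + a) * Real.exp (-a * t) :=
      eq_of_deriv_zero hd τ hτ
    simp only
    rw [← hconst, mul_assoc, ← Real.exp_add]
    simp
  · refine (((((hj.deriv₁ τ hτ).add
      (((hj.deriv₀ τ hτ).add_const a).const_mul (-a))).pow 2).const_mul ((a / 4) ^ 2)).add
        (((hj.deriv₂ τ hτ).add ((hj.deriv₁ τ hτ).const_mul (-a))).pow 2)).congr_deriv ?_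
    simp only [Pi.add_apply]
    push_cast
    ring
  · obtain ⟨b0, b1⟩ := ht' τ (le_trans hτ (min_le_left _ _))
    generalize f₁ τ + -a * (f τ + a) = y
    generalize f₂ τ + -a * f₁ τ = w
    generalize f τ + a = z at b0
    generalize f₁ τ = z₁ at b1
    have e1 : z₁ * (y * w) * 2 ≤ a / 4 * ((a / 4) ^ 2 * y ^ 2 + w ^ 2) := by
      have h1 : z₁ * (y * w) ≤ a ^ 2 / 16 * |y * w| := by
        calc z₁ * (y * w) ≤ |z₁ * (y * w)| := le_abs_self _
          _ = |z₁| * |y * w| := abs_mul _ _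
          _ ≤ _ := mul_le_mul_of_nonneg_right b1.le (abs_nonneg _)
      have h2 : a / 4 * |y * w| * 2 ≤ (a / 4) ^ 2 * y ^ 2 + w ^ 2 := by
        have := sq_nonneg (a / 4 * |y| - |w|)
        rw [abs_mul]
        nlinarith [sq_abs y, sq_abs w]
      nlinarith
    have e2 : -(z * w ^ 2) * 2 ≤ a / 4 * ((a / 4) ^ 2 * y ^ 2 + w ^ 2) := by
      have h1 : -z ≤ a / 8 := by linarith [(abs_lt.1 b0).1]
      have h2 := mul_le_mul_of_nonneg_right h1 (sq_nonneg w)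
      have h3 : 0 ≤ a / 4 * ((a / 4) ^ 2 * y ^ 2) := by positivity
      linarith
    have e3 : 2 * (a / 4) ^ 2 * y * w ≤ a / 4 * ((a / 4) ^ 2 * y ^ 2 + w ^ 2) := by
      have := mul_nonneg (by positivity : 0 ≤ a / 4) (sq_nonneg (a / 4 * y - w))
      linarith
    have e4 : 0 ≤ a / 4 * ((a / 4) ^ 2 * y ^ 2 + w ^ 2) := by positivity
    linarith
  · have t1 := hy (a / 2) (by positivity) (by linarith)
    have t2 := hw (a / 2) (by positivity) (by linarith)
    have t3 := ((t1.pow 2).const_mul ((a / 4) ^ 2)).add (t2.pow 2)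
    norm_num at t3
    refine t3.congr fun τ => ?_
    have : Real.exp (-a * τ) = Real.exp (-(a / 2) * τ) ^ 2 := by
      rw [← Real.exp_nat_mul]; push_cast; ring_nf
    rw [this]
    ring_nf

/-! ### The profile for `m = 1/3` -/

/-- The time at which `u = √(-Φ)` takes a given value, for `m = 1/3` and `a = α²`: the primitive
of `3 / (u³ - α³)` on `(-∞, α)` that vanishes at `0`. Unlike `tauThird`, it also covers `u < 0`,
where the solution continues past `τ = 0`. -/
noncomputable def thirdTime (α u : ℝ) : ℝ :=
  √3 * Real.pi / (6 * α ^ 2)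
    - 1 / (2 * α ^ 2) * Real.log ((α ^ 2 + α * u + u ^ 2) / (α - u) ^ 2)
    - √3 / α ^ 2 * Real.arctan ((α + 2 * u) / (√3 * α))

/-- The end `2 √3 π / (3 a)`, `a = α²`, of the lifespan of the solution for `m = 1/3`. -/
noncomputable def blowUpTime (α : ℝ) : ℝ := 2 * Real.pi * √3 / (3 * α ^ 2)

/-- The regular factor of `exp (a * thirdTime α u)`, which has a simple zero at `u = α`. -/
noncomputable def thirdFactor (α u : ℝ) : ℝ :=
  Real.exp (√3 * Real.pi / 6 - √3 * Real.arctan ((α + 2 * u) / (√3 * α)))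
    / √(α ^ 2 + α * u + u ^ 2)

variable {α : ℝ}

theorem quad_pos (hα : 0 < α) (u : ℝ) : 0 < α ^ 2 + α * u + u ^ 2 := by
  nlinarith [sq_nonneg (α + 2 * u), pow_pos hα 2]

theorem hasDerivAt_thirdTime (hα : 0 < α) {u : ℝ} (hu : u < α) :
    HasDerivAt (thirdTime α) (3 / (u ^ 3 - α ^ 3)) u := by
  have hs : √3 ^ 2 = (3 : ℝ) := Real.sq_sqrt (by norm_num)
  have hs0 : 0 < √(3 : ℝ) := Real.sqrt_pos.2 (by norm_num)
  have hq := quad_pos hα u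
  have hd : 0 < α - u := by linarith
  have h1 : HasDerivAt (fun u : ℝ => α ^ 2 + α * u + u ^ 2) (α + 2 * u) u := by
    refine ((((hasDerivAt_id u).const_mul α).const_add (α ^ 2)).add
      ((hasDerivAt_id u).pow 2)).congr_deriv ?_
    simp
  have h2 : HasDerivAt (fun u : ℝ => (α - u) ^ 2) (2 * (α - u) * (-1)) u := by
    refine (((hasDerivAt_id u).const_sub α).pow 2).congr_deriv ?_
    simp
  have h3 := ((h1.div h2 (by positivity)).log (div_pos hq (by positivity)).ne').const_mul
    (1 / (2 * α ^ 2))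
  have h4 : HasDerivAt (fun u : ℝ => (α + 2 * u) / (√3 * α)) (2 / (√3 * α)) u := by
    refine ((((hasDerivAt_id u).const_mul 2).const_add α).div_const (√3 * α)).congr_deriv ?_
    simp
  have h5 := h4.arctan.const_mul (√3 / α ^ 2)
  refine ((h3.const_sub (√3 * Real.pi / (6 * α ^ 2))).sub h5).congr_deriv ?_
  have hne : u ^ 3 - α ^ 3 = -((α - u) * (α ^ 2 + α * u + u ^ 2)) := by ring
  have e1 : 1 + ((α + 2 * u) / (√3 * α)) ^ 2
      = 4 * (α ^ 2 + α * u + u ^ 2) / (3 * α ^ 2) := by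
    rw [div_pow, mul_pow, hs]; field_simp; ring
  rw [hne, e1]
  have e2 : √3 / α ^ 2 * (1 / (4 * (α ^ 2 + α * u + u ^ 2) / (3 * α ^ 2)) * (2 / (√3 * α)))
      = 3 / (2 * α * (α ^ 2 + α * u + u ^ 2)) := by
    field_simp
    ring
  rw [e2]
  set q := α ^ 2 + α * u + u ^ 2 with hq'
  simp only [Pi.div_apply]
  rw [← hq']
  field_simp
  rw [hq']
  ring

theorem exp_thirdTime (hα : 0 < α) {u : ℝ} (hu : u < α) :
    Real.exp (α ^ 2 * thirdTime α u) = (α - u) * thirdFactor α u := by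
  have hq := quad_pos hα u
  have hd : 0 < α - u := by linarith
  have h1 : Real.log ((α ^ 2 + α * u + u ^ 2) / (α - u) ^ 2)
      = 2 * (Real.log √(α ^ 2 + α * u + u ^ 2) - Real.log (α - u)) := by
    rw [Real.log_div hq.ne' (by positivity), Real.log_sqrt hq.le, Real.log_pow]
    push_cast; ring
  have h2 : α ^ 2 * thirdTime α u = (√3 * Real.pi / 6
      - √3 * Real.arctan ((α + 2 * u) / (√3 * α)))
      - Real.log √(α ^ 2 + α * u + u ^ 2) + Real.log (α - u) := by
    rw [thirdTime, h1]
    field_simp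
    ring
  rw [h2, Real.exp_add, Real.exp_sub, Real.exp_log hd, Real.exp_log (Real.sqrt_pos.2 hq),
    thirdFactor]
  ring

theorem thirdFactor_pos (hα : 0 < α) (u : ℝ) : 0 < thirdFactor α u :=
  div_pos (Real.exp_pos _) (Real.sqrt_pos.2 (quad_pos hα u))

theorem continuous_thirdFactor (hα : 0 < α) : Continuous (thirdFactor α) := by
  unfold thirdFactor
  refine Continuous.div ?_ (by fun_prop) fun u => (Real.sqrt_pos.2 (quad_pos hα u)).ne'
  exact Real.continuous_exp.comp (continuous_const.sub (continuous_const.mul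
    (Real.continuous_arctan.comp (by fun_prop))))

theorem thirdFactor_self (hα : 0 < α) :
    thirdFactor α α = Real.exp (-(√3 * Real.pi / 6)) / (√3 * α) := by
  have hs : √3 ^ 2 = (3 : ℝ) := Real.sq_sqrt (by norm_num)
  have hs0 : 0 < √(3 : ℝ) := Real.sqrt_pos.2 (by norm_num)
  have h1 : (α + 2 * α) / (√3 * α) = √3 := by
    field_simp; linarith
  have h2 : √(α ^ 2 + α * α + α ^ 2) = √3 * α := by
    rw [show α ^ 2 + α * α + α ^ 2 = 3 * α ^ 2 by ring, Real.sqrt_mul (by norm_num),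
      Real.sqrt_sq hα.le]
  rw [thirdFactor, h1, h2, Real.arctan_sqrt_three]
  congr 2
  ring

theorem thirdTime_zero (hα : 0 < α) : thirdTime α 0 = 0 := by
  have hs0 : 0 < √(3 : ℝ) := Real.sqrt_pos.2 (by norm_num)
  have h1 : (α + 2 * 0) / (√3 * α) = (√3)⁻¹ := by
    field_simp; ring
  rw [thirdTime, h1, Real.arctan_inv_sqrt_three]
  have h2 : (α ^ 2 + α * 0 + 0 ^ 2) / (α - 0) ^ 2 = 1 := by
    simp [hα.ne']
  rw [h2]
  simp
  field_simp
  ring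

theorem strictAntiOn_thirdTime (hα : 0 < α) : StrictAntiOn (thirdTime α) (Iio α) := by
  refine strictAntiOn_of_deriv_neg (convex_Iio α)
    (fun u hu => (hasDerivAt_thirdTime hα hu).continuousAt.continuousWithinAt) fun u hu => ?_
  rw [interior_Iio] at hu
  rw [(hasDerivAt_thirdTime hα hu).deriv]
  refine div_neg_of_pos_of_neg (by norm_num) ?_
  have := quad_pos hα u
  have hu' : 0 < α - u := sub_pos.2 hu
  nlinarith [mul_pos hu' this]

theorem tendsto_thirdTime_atBot (hα : 0 < α) :
    Tendsto (thirdTime α) atBot (𝓝 (blowUpTime α)) := by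
  have hs0 : 0 < √(3 : ℝ) := Real.sqrt_pos.2 (by norm_num)
  have hi : Tendsto (fun u : ℝ => u⁻¹) atBot (𝓝 0) := tendsto_inv_atBot_zero
  have h1 : Tendsto (fun u : ℝ => Real.log ((α ^ 2 + α * u + u ^ 2) / (α - u) ^ 2)) atBot
      (𝓝 0) := by
    have hc : ContinuousAt
        (fun t : ℝ => Real.log (((α * t) ^ 2 + α * t + 1) / (α * t - 1) ^ 2)) 0 := by
      refine ContinuousAt.log (ContinuousAt.div (by fun_prop) (by fun_prop) (by norm_num))
        (by norm_num)
    have := hc.tendsto.comp hi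
    norm_num at this
    refine this.congr' ?_
    filter_upwards [eventually_lt_atBot 0] with u hu
    have hd : α - u ≠ 0 := by linarith
    have hu0 := hu.ne
    simp only [Function.comp, ← div_eq_mul_inv]
    rw [div_sub_one hu0]
    congr 1
    field_simp
  have h2 : Tendsto (fun u : ℝ => Real.arctan ((α + 2 * u) / (√3 * α))) atBot
      (𝓝 (-(Real.pi / 2))) := by
    refine (Real.tendsto_arctan_atBot.mono_right nhdsWithin_le_nhds).comp ?_
    exact (tendsto_atBot_add_const_left _ _ (tendsto_id.const_mul_atBot two_pos)).atBot_div_const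
      (by positivity)
  have h3 := ((h1.const_mul (1 / (2 * α ^ 2))).const_sub (√3 * Real.pi / (6 * α ^ 2))).sub
    (h2.const_mul (√3 / α ^ 2))
  have h4 : √3 * Real.pi / (6 * α ^ 2) - 1 / (2 * α ^ 2) * 0 - √3 / α ^ 2 * -(Real.pi / 2)
      = blowUpTime α := by
    rw [blowUpTime]; field_simp; ring
  rwa [h4] at h3

theorem thirdTime_lt (hα : 0 < α) {u : ℝ} (hu : u < α) : thirdTime α u < blowUpTime α := by
  have h1 : thirdTime α (u - 1) ≤ blowUpTime α := by
    refine ge_of_tendsto (tendsto_thirdTime_atBot hα) ?_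
    filter_upwards [eventually_le_atBot (u - 1)] with v hv
    exact (strictAntiOn_thirdTime hα).antitoneOn (by simp; linarith) (by simp; linarith) hv
  exact lt_of_lt_of_le (strictAntiOn_thirdTime hα (show u - 1 < α by linarith) hu (by linarith)) h1

theorem exists_thirdTime_eq (hα : 0 < α) {τ : ℝ} (hτ : τ < blowUpTime α) :
    ∃ u < α, thirdTime α u = τ := by
  have hc : ContinuousOn (thirdTime α) (Iio α) := fun u hu =>
    (hasDerivAt_thirdTime hα hu).continuousAt.continuousWithinAt
  obtain ⟨v, hv, hvα⟩ : ∃ v, τ < thirdTime α v ∧ v < α :=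
    (((tendsto_thirdTime_atBot hα).eventually (lt_mem_nhds hτ)).and
      (eventually_lt_atBot α)).exists
  obtain ⟨w, hw, hwα⟩ : ∃ w, thirdTime α w < τ ∧ w < α := by
    have h1 : Tendsto (fun u => (α - u) * thirdFactor α u) (𝓝[<] α) (𝓝 0) := by
      have : Continuous fun u => (α - u) * thirdFactor α u :=
        (continuous_const.sub continuous_id).mul (continuous_thirdFactor hα)
      simpa using (this.tendsto α).mono_left nhdsWithin_le_nhds
    have h2 := (h1.eventually (gt_mem_nhds (Real.exp_pos (α ^ 2 * τ)))).and self_mem_nhdsWithin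
    obtain ⟨w, hw, hwα⟩ := h2.exists
    refine ⟨w, ?_, hwα⟩
    rw [← exp_thirdTime hα hwα, Real.exp_lt_exp] at hw
    exact lt_of_mul_lt_mul_left hw (by positivity)
  have := isPreconnected_Iio.intermediate_value (s := Iio α) hwα hvα hc
  obtain ⟨u, hu, h⟩ := this ⟨hw.le, hv.le⟩
  exact ⟨u, hu, h⟩

/-- The inverse function of `thirdTime α : (-∞, α) → (-∞, blowUpTime α)`. The solution of the
boundary value problem for `m = 1/3` is `-(thirdProfile α τ)²`. -/
noncomputable def thirdProfile (α : ℝ) : ℝ → ℝ := Function.invFunOn (thirdTime α) (Iio α)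

theorem thirdProfile_lt (hα : 0 < α) {τ : ℝ} (hτ : τ < blowUpTime α) : thirdProfile α τ < α :=
  Function.invFunOn_mem (f := thirdTime α) (s := Iio α) (exists_thirdTime_eq hα hτ)

theorem thirdTime_thirdProfile (hα : 0 < α) {τ : ℝ} (hτ : τ < blowUpTime α) :
    thirdTime α (thirdProfile α τ) = τ :=
  Function.invFunOn_eq (f := thirdTime α) (s := Iio α) (exists_thirdTime_eq hα hτ)

theorem thirdProfile_thirdTime (hα : 0 < α) {u : ℝ} (hu : u < α) :
    thirdProfile α (thirdTime α u) = u :=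
  (strictAntiOn_thirdTime hα).injOn (thirdProfile_lt hα (thirdTime_lt hα hu)) hu
    (thirdTime_thirdProfile hα (thirdTime_lt hα hu))

theorem thirdProfile_lt_iff (hα : 0 < α) {τ u : ℝ} (hτ : τ < blowUpTime α) (hu : u < α) :
    thirdProfile α τ < u ↔ thirdTime α u < τ := by
  conv_rhs => rw [← thirdTime_thirdProfile hα hτ]
  exact ((strictAntiOn_thirdTime hα).lt_iff_gt hu (thirdProfile_lt hα hτ)).symm

theorem lt_thirdProfile_iff (hα : 0 < α) {τ u : ℝ} (hτ : τ < blowUpTime α) (hu : u < α) :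
    u < thirdProfile α τ ↔ τ < thirdTime α u := by
  conv_rhs => rw [← thirdTime_thirdProfile hα hτ]
  exact ((strictAntiOn_thirdTime hα).lt_iff_gt (thirdProfile_lt hα hτ) hu).symm

theorem thirdProfile_zero (hα : 0 < α) : thirdProfile α 0 = 0 := by
  conv_lhs => rw [← thirdTime_zero hα]
  exact thirdProfile_thirdTime hα hα

theorem blowUpTime_pos (hα : 0 < α) : 0 < blowUpTime α := by
  have := thirdTime_lt hα hα
  rwa [thirdTime_zero hα] at this

theorem strictAntiOn_thirdProfile (hα : 0 < α) :
    StrictAntiOn (thirdProfile α) (Iio (blowUpTime α)) := fun τ hτ σ hσ h => by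
  rw [thirdProfile_lt_iff hα hσ (thirdProfile_lt hα hτ), thirdTime_thirdProfile hα hτ]
  exact h

theorem hasDerivAt_thirdProfile (hα : 0 < α) {τ : ℝ} (hτ : τ < blowUpTime α) :
    HasDerivAt (thirdProfile α) ((thirdProfile α τ ^ 3 - α ^ 3) / 3) τ := by
  have hu := thirdProfile_lt hα hτ
  have hc : ContinuousAt (fun τ => -thirdProfile α τ) τ := by
    refine StrictMonoOn.continuousAt_of_image_mem_nhds (s := Iio (blowUpTime α))
      (strictAntiOn_thirdProfile hα).neg (Iio_mem_nhds hτ) ?_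
    refine mem_of_superset (Ioi_mem_nhds (neg_lt_neg hu)) fun x hx => ?_
    have hx' : -x < α := by rw [mem_Ioi] at hx; linarith
    exact ⟨thirdTime α (-x), thirdTime_lt hα hx', by simp [thirdProfile_thirdTime hα hx']⟩
  have hc' : ContinuousAt (thirdProfile α) τ :=
    hc.neg.congr (Eventually.of_forall fun _ => neg_neg _)
  have hne : thirdProfile α τ ^ 3 - α ^ 3 ≠ 0 := by
    have := mul_pos (sub_pos.2 hu) (quad_pos hα (thirdProfile α τ))
    nlinarith
  have := HasDerivAt.of_local_left_inverse hc' (hasDerivAt_thirdTime hα hu)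
    (div_ne_zero (by norm_num) hne)
    (eventually_of_mem (Iio_mem_nhds hτ) fun σ hσ => thirdTime_thirdProfile hα hσ)
  rwa [inv_div] at this

theorem tendsto_thirdProfile_blowUpTime (hα : 0 < α) :
    Tendsto (thirdProfile α) (𝓝[<] (blowUpTime α)) atBot := by
  refine tendsto_atBot.2 fun M => ?_
  have hM : min M 0 < α := lt_of_le_of_lt (min_le_right _ _) hα
  filter_upwards [Ioo_mem_nhdsLT (thirdTime_lt hα hM)] with τ hτ
  exact (((thirdProfile_lt_iff hα hτ.2 hM).2 hτ.1).le).trans (min_le_left _ _)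

theorem tendsto_thirdProfile_atBot (hα : 0 < α) :
    Tendsto (thirdProfile α) atBot (𝓝 α) := by
  refine tendsto_order.2 ⟨fun u hu => ?_, fun u hu => ?_⟩
  · filter_upwards [eventually_lt_atBot (thirdTime α u), eventually_lt_atBot (blowUpTime α)]
      with τ h1 h2
    exact (lt_thirdProfile_iff hα h2 hu).2 h1
  · filter_upwards [eventually_lt_atBot (blowUpTime α)] with τ h2
    exact (thirdProfile_lt hα h2).trans hu

theorem sub_thirdProfile (hα : 0 < α) {τ : ℝ} (hτ : τ < blowUpTime α) :
    α - thirdProfile α τ = Real.exp (α ^ 2 * τ) / thirdFactor α (thirdProfile α τ) := by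
  rw [eq_div_iff (thirdFactor_pos hα _).ne', ← exp_thirdTime hα (thirdProfile_lt hα hτ),
    thirdTime_thirdProfile hα hτ]

theorem expDecay_sub_thirdProfile (hα : 0 < α) :
    ExpDecay (α ^ 2) (fun τ => α - thirdProfile α τ) := by
  have h1 : ExpDecay (α ^ 2) (fun τ => Real.exp (α ^ 2 * τ)) :=
    ExpDecay.of_le_exp (C := 1) (T := 0) fun τ _ => by simp
  have h2 : Tendsto (fun τ => (thirdFactor α (thirdProfile α τ))⁻¹) atBot (𝓝 (thirdFactor α α)⁻¹) :=
    (((continuous_thirdFactor hα).tendsto α).comp (tendsto_thirdProfile_atBot hα)).inv₀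
      (thirdFactor_pos hα α).ne'
  refine (h1.mul_tendsto h2).congr' ?_
  filter_upwards [eventually_lt_atBot (blowUpTime α)] with τ hτ
  rw [sub_thirdProfile hα hτ, div_eq_mul_inv]

/-- `-U²` solves the equation for `m = 1/3` when `U' = (U³ - α³) / 3`; here up to a time shift
`c`. -/
theorem thirdProfile_isSolutionJet (hα : 0 < α) (c : ℝ) {S : Set ℝ}
    (hS : ∀ τ ∈ S, τ + c < blowUpTime α) :
    IsSolutionJet (-2) S (fun τ => -thirdProfile α (τ + c) ^ 2)
      (fun τ => 2 / 3 * (thirdProfile α (τ + c) * (α ^ 3 - thirdProfile α (τ + c) ^ 3)))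
      (fun τ => 2 / 9 * ((α ^ 3 - 4 * thirdProfile α (τ + c) ^ 3)
        * (thirdProfile α (τ + c) ^ 3 - α ^ 3))) := by
  have h : ∀ τ ∈ S, HasDerivAt (fun τ => thirdProfile α (τ + c))
      ((thirdProfile α (τ + c) ^ 3 - α ^ 3) / 3) τ := fun τ hτ => by
    simpa using (hasDerivAt_thirdProfile hα (hS τ hτ)).comp_add_const τ c
  refine ⟨fun τ hτ => ?_, fun τ hτ => ?_, fun τ hτ => ?_⟩
  · refine (((h τ hτ).pow 2).neg.congr_deriv ?_).hasDerivWithinAt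
    push_cast
    ring
  · refine ((((h τ hτ).mul (((h τ hτ).pow 3).const_sub (α ^ 3))).const_mul (2 / 3)).congr_deriv
      ?_).hasDerivWithinAt
    push_cast
    simp only [Pi.pow_apply]
    ring
  · refine ((((((((h τ hτ).pow 3).const_mul 4).const_sub (α ^ 3))).mul
      (((h τ hτ).pow 3).sub_const (α ^ 3))).const_mul (2 / 9)).congr_deriv ?_).hasDerivWithinAt
    push_cast
    simp only [Pi.pow_apply]
    ring

/-! ### Uniqueness for `m = 1/3` -/

namespace IsSolutionJet

variable {α T : ℝ} {f f₁ f₂ : ℝ → ℝ}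

/-- The first integral for `m = 1/3`, obtained by multiplying `(f'' + f f')' = -(f')²` by `f`. -/
theorem first_integral_third {a : ℝ} (h : IsSolutionJet (-2) (Iic T) f f₁ f₂)
    (l₀ : Tendsto f atBot (𝓝 a)) (l₁ : Tendsto f₁ atBot (𝓝 0)) (l₂ : Tendsto f₂ atBot (𝓝 0)) :
    ∀ τ ∈ Iic T, f τ * f₂ τ - f₁ τ ^ 2 / 2 + f τ ^ 2 * f₁ τ = 0 := by
  refine eq_of_tendsto_of_deriv_zero (fun τ hτ => ?_)
    (by simpa using ((l₀.mul l₂).sub ((l₁.pow 2).div_const 2)).add ((l₀.pow 2).mul l₁))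
  refine ((((h.deriv₀ τ hτ).mul (h.deriv₂ τ hτ)).sub (((h.deriv₁ τ hτ).pow 2).div_const 2)).add
    (((h.deriv₀ τ hτ).pow 2).mul (h.deriv₁ τ hτ))).congr_deriv ?_
  simp only [Pi.pow_apply]
  push_cast
  ring

/-- While `-α² < f < 0`, the function `u = √(-f)` satisfies `u'' = u² u'`, hence
`u' = (u³ - α³) / 3`, so `f` is a translate of the explicit solution. -/
theorem exists_eqOn_thirdProfile_shift (hα : 0 < α) (h : IsSolutionJet (-2) (Iic T) f f₁ f₂)
    (l₀ : Tendsto f atBot (𝓝 (-α ^ 2))) (l₁ : Tendsto f₁ atBot (𝓝 0))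
    (l₂ : Tendsto f₂ atBot (𝓝 0)) (hneg : ∀ τ ∈ Iic T, f τ < 0)
    (hgt : ∀ τ ∈ Iic T, -α ^ 2 < f τ) :
    ∃ c, T + c < blowUpTime α ∧ EqOn f (fun τ => -thirdProfile α (τ + c) ^ 2) (Iic T) := by
  have hI := h.first_integral_third l₀ l₁ l₂
  have hu0 : ∀ τ ∈ Iic T, 0 < √(-f τ) := fun τ hτ => Real.sqrt_pos.2 (neg_pos.2 (hneg τ hτ))
  have husq : ∀ τ ∈ Iic T, √(-f τ) ^ 2 = -f τ := fun τ hτ =>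
    Real.sq_sqrt (neg_pos.2 (hneg τ hτ)).le
  have huα : ∀ τ ∈ Iic T, √(-f τ) < α := fun τ hτ => by
    rw [Real.sqrt_lt' hα]; linarith [hgt τ hτ]
  have hu : ∀ τ ∈ Iic T, HasDerivWithinAt (fun τ => √(-f τ)) (-f₁ τ / (2 * √(-f τ))) (Iic T) τ :=
    fun τ hτ => (h.deriv₀ τ hτ).neg.sqrt (neg_pos.2 (hneg τ hτ)).ne'
  have lu : Tendsto (fun τ => √(-f τ)) atBot (𝓝 α) := by
    have := (Real.continuous_sqrt.tendsto (α ^ 2)).comp (by simpa using l₀.neg :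
      Tendsto (fun τ => -f τ) atBot (𝓝 (α ^ 2)))
    rwa [Real.sqrt_sq hα.le] at this
  have hw : ∀ τ ∈ Iic T, -f₁ τ / (2 * √(-f τ)) - √(-f τ) ^ 3 / 3 = -α ^ 3 / 3 := by
    refine eq_of_tendsto_of_deriv_zero (fun τ hτ => ?_) ?_
    · refine (((h.deriv₁ τ hτ).neg.div ((hu τ hτ).const_mul 2) (by
        have := hu0 τ hτ; positivity)).sub (((hu τ hτ).pow 3).div_const 3)).congr_deriv ?_
      have e1 := hI τ hτ
      have e2 := husq τ hτ
      have e3 := hu0 τ hτ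
      simp only [Pi.neg_apply]
      generalize √(-f τ) = u at *
      have e4 : f τ = -u ^ 2 := by linarith
      rw [e4] at e1
      field_simp
      push_cast
      linear_combination 6 * e1
    · have := (l₁.neg.div (lu.const_mul 2) (by positivity)).sub ((lu.pow 3).div_const 3)
      rw [show -0 / (2 * α) - α ^ 3 / 3 = -α ^ 3 / 3 by ring] at this
      exact this
  have hS := eq_of_deriv_zero (g := fun τ => thirdTime α (√(-f τ)) - τ) (T := T) fun τ hτ => by
    refine (((hasDerivAt_thirdTime hα (huα τ hτ)).comp_hasDerivWithinAt τ (hu τ hτ)).sub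
      (hasDerivWithinAt_id τ _)).congr_deriv ?_
    have h1 : -f₁ τ / (2 * √(-f τ)) = (√(-f τ) ^ 3 - α ^ 3) / 3 := by linarith [hw τ hτ]
    have h2 := mul_pos (sub_pos.2 (huα τ hτ)) (quad_pos hα (√(-f τ)))
    have h3 : √(-f τ) ^ 3 - α ^ 3 ≠ 0 := by nlinarith
    rw [h1]
    field_simp
    norm_num
  refine ⟨thirdTime α (√(-f T)) - T, ?_, fun τ hτ => ?_⟩
  · rw [add_sub_cancel]
    exact thirdTime_lt hα (huα T self_mem_Iic)
  · have h1 := hS τ hτ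
    simp only at h1 ⊢
    rw [← h1, add_sub_cancel, thirdProfile_thirdTime hα (huα τ hτ), husq τ hτ, neg_neg]

/-- A solution that is a translate of the explicit one near `-∞` is so throughout, and therefore
ends before the blow-up time. -/
theorem eqOn_thirdProfile_shift (hα : 0 < α) (h : IsSolutionJet (-2) (Iic T) f f₁ f₂) {t c : ℝ}
    (htT : t ≤ T) (htc : t + c < blowUpTime α)
    (he : EqOn f (fun τ => -thirdProfile α (τ + c) ^ 2) (Iic t)) :
    T + c < blowUpTime α ∧ EqOn f (fun τ => -thirdProfile α (τ + c) ^ 2) (Iic T) := by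
  have key : ∀ s, t ≤ s → s ≤ T → s + c < blowUpTime α →
      EqOn f (fun τ => -thirdProfile α (τ + c) ^ 2) (Iic s) := fun s h1 h2 h3 =>
    (h.mono (Iic_subset_Iic.2 h2)).eqOn_Iic
      (thirdProfile_isSolutionJet hα c fun τ hτ => by rw [mem_Iic] at hτ; linarith) h1 he
  have hT : T + c < blowUpTime α := by
    by_contra! hT
    have hb : blowUpTime α - c ∈ Iic T := by rw [mem_Iic]; linarith
    have h1 : Tendsto f (𝓝[<] (blowUpTime α - c)) (𝓝 (f (blowUpTime α - c))) :=
      (h.continuousOn₀ _ hb).tendsto.mono_left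
        (nhdsWithin_mono _ fun x hx => mem_Iic.2 ((mem_Iio.1 hx).le.trans hb))
    have h2 : Tendsto (fun τ => -thirdProfile α (τ + c) ^ 2) (𝓝[<] (blowUpTime α - c)) atBot := by
      have hs : Tendsto (fun τ => τ + c) (𝓝[<] (blowUpTime α - c)) (𝓝[<] (blowUpTime α)) := by
        refine tendsto_nhdsWithin_iff.2 ⟨?_, ?_⟩
        · have : Tendsto (fun τ => τ + c) (𝓝 (blowUpTime α - c)) (𝓝 (blowUpTime α - c + c)) :=
            tendsto_id.add_const c
          rw [sub_add_cancel] at this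
          exact this.mono_left nhdsWithin_le_nhds
        · filter_upwards [self_mem_nhdsWithin] with τ hτ
          exact mem_Iio.2 (lt_sub_iff_add_lt.1 (mem_Iio.1 hτ))
      have h3 := (tendsto_thirdProfile_blowUpTime hα).comp hs
      have h4 := h3.atBot_mul_atBot₀ h3
      exact (tendsto_neg_atTop_atBot.comp h4).congr fun τ => by simp [sq]
    refine not_tendsto_nhds_of_tendsto_atBot (h2.congr' ?_) _ h1
    filter_upwards [Ioo_mem_nhdsLT (show t < blowUpTime α - c by linarith)] with τ hτ
    exact (key τ hτ.1.le (hτ.2.le.trans hb) (by linarith [hτ.2]) self_mem_Iic).symm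
  exact ⟨hT, key T htT le_rfl hT⟩

/-- Since `f'' + f f' = -∫ (f')² ≤ 0`, the function `f' exp (∫ f)` is antitone: once `f` decreases
it does so forever, which is incompatible with `f(-∞) < 0 = f(0)` unless `f' ≥ 0` near `-∞`. -/
theorem exists_deriv_nonneg_third (hα : 0 < α) (hT : 0 ≤ T)
    (h : IsSolutionJet (-2) (Iic T) f f₁ f₂)
    (l₀ : Tendsto f atBot (𝓝 (-α ^ 2))) (l₁ : Tendsto f₁ atBot (𝓝 0))
    (l₂ : Tendsto f₂ atBot (𝓝 0)) (h0 : f 0 = 0) : ∃ t ≤ T, ∀ τ ≤ t, 0 ≤ f₁ τ := by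
  have hP : ∀ τ ∈ Iic T, f₂ τ + f τ * f₁ τ ≤ 0 := fun τ hτ => by
    have hanti : AntitoneOn (fun τ => f₂ τ + f τ * f₁ τ) (Iic T) :=
      antitoneOn_Iic_of_deriv_nonpos (fun τ hτ => (h.deriv₂ τ hτ).add
        ((h.deriv₀ τ hτ).mul (h.deriv₁ τ hτ))) fun τ _ => by nlinarith [sq_nonneg (f₁ τ)]
    refine ge_of_tendsto (by simpa using l₂.add (l₀.mul l₁)) ?_
    filter_upwards [eventually_le_atBot τ] with s hs
    exact hanti (le_trans hs hτ : s ∈ Iic T) hτ hs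
  -- Clamping at `T` extends `f` continuously, so that `∫ f` is differentiable at `T` as well.
  have hg : Continuous fun τ => f (min τ T) :=
    h.continuousOn₀.comp_continuous (by fun_prop) fun τ => min_le_right τ T
  have hF : ∀ τ, HasDerivAt (fun τ => ∫ x in (0 : ℝ)..τ, f (min x T)) (f (min τ T)) τ := fun τ =>
    intervalIntegral.integral_hasDerivAt_right (hg.intervalIntegrable _ _)
      (hg.stronglyMeasurableAtFilter _ _) hg.continuousAt
  have hanti : AntitoneOn (fun τ => f₁ τ * Real.exp (∫ x in (0 : ℝ)..τ, f (min x T))) (Iic T) := by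
    refine antitoneOn_Iic_of_deriv_nonpos
      (fun τ hτ => (h.deriv₁ τ hτ).mul (hF τ).exp.hasDerivWithinAt) fun τ hτ => ?_
    rw [min_eq_left hτ]
    have := mul_nonneg (neg_nonneg.2 (hP τ hτ)) (Real.exp_pos (∫ x in (0 : ℝ)..τ, f (min x T))).le
    linarith
  by_contra! hc
  have hf₁ : ∀ τ ∈ Iic T, f₁ τ ≤ 0 := fun τ hτ => by
    obtain ⟨s, hs, hs'⟩ := hc τ hτ
    have h1 := hanti (le_trans hs hτ : s ∈ Iic T) hτ hs
    simp only at h1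
    by_contra! h2
    have h3 := mul_pos h2 (Real.exp_pos (∫ x in (0 : ℝ)..τ, f (min x T)))
    have h4 := mul_neg_of_neg_of_pos hs' (Real.exp_pos (∫ x in (0 : ℝ)..s, f (min x T)))
    linarith
  have hfa := antitoneOn_Iic_of_deriv_nonpos h.deriv₀ hf₁
  have : (0 : ℝ) ≤ -α ^ 2 := by
    refine ge_of_tendsto l₀ ?_
    filter_upwards [eventually_le_atBot 0] with s hs
    rw [← h0]
    exact hfa (le_trans hs hT : s ∈ Iic T) hT hs
  have : 0 < α ^ 2 := by positivity
  linarith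

theorem eqOn_thirdProfile (hα : 0 < α) (hT : 0 ≤ T) (h : IsSolutionJet (-2) (Iic T) f f₁ f₂)
    (l₀ : Tendsto f atBot (𝓝 (-α ^ 2))) (l₁ : Tendsto f₁ atBot (𝓝 0))
    (l₂ : Tendsto f₂ atBot (𝓝 0)) (h0 : f 0 = 0) :
    T < blowUpTime α ∧ EqOn f (fun τ => -thirdProfile α τ ^ 2) (Iic T) := by
  have hα2 : 0 < α ^ 2 := by positivity
  obtain ⟨t₁, ht₁, hf₁⟩ := h.exists_deriv_nonneg_third hα hT l₀ l₁ l₂ h0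
  obtain ⟨t₂, ht₂⟩ := eventually_atBot.1 (l₀.eventually (gt_mem_nhds (by linarith : -α ^ 2 < 0)))
  set t := min t₁ t₂
  have htT : t ≤ T := (min_le_left _ _).trans ht₁
  have hj := h.mono (Iic_subset_Iic.2 htT)
  have hmono : MonotoneOn f (Iic t) := by
    have := antitoneOn_Iic_of_deriv_nonpos (fun τ hτ => (hj.deriv₀ τ hτ).neg)
      fun τ hτ => neg_nonpos.2 (hf₁ τ (le_trans hτ (min_le_left _ _)))
    simpa using this.neg
  have hge : ∀ τ ∈ Iic t, -α ^ 2 ≤ f τ := fun τ hτ => by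
    refine le_of_tendsto l₀ ?_
    filter_upwards [eventually_le_atBot τ] with s hs
    exact hmono (le_trans hs hτ : s ∈ Iic t) hτ hs
  have hgt : ∀ τ ∈ Iic t, -α ^ 2 < f τ := fun τ hτ => by
    refine lt_of_le_of_ne (hge τ hτ) fun heq => ?_
    have hconst : IsSolutionJet (-2) (Iic T) (fun _ => -α ^ 2) (fun _ => 0) (fun _ => 0) := by
      refine ⟨fun s _ => hasDerivWithinAt_const _ _ _, fun s _ => hasDerivWithinAt_const _ _ _,
        fun s _ => (hasDerivWithinAt_const _ _ _).congr_deriv (by ring)⟩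
    have := h.eqOn_Iic hconst (le_trans hτ htT) (fun s hs => le_antisymm
      ((hmono (mem_Iic.2 ((mem_Iic.1 hs).trans hτ)) hτ hs).trans heq.symm.le)
        (hge s (mem_Iic.2 ((mem_Iic.1 hs).trans hτ)))) hT
    simp only at this
    linarith
  obtain ⟨c, hc, he⟩ := hj.exists_eqOn_thirdProfile_shift hα l₀ l₁ l₂
    (fun τ hτ => ht₂ τ (le_trans hτ (min_le_right _ _))) hgt
  obtain ⟨hTc, hE⟩ := h.eqOn_thirdProfile_shift hα htT hc he
  have hUc : thirdProfile α c = 0 := by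
    have := hE hT
    simp only [h0, zero_add] at this
    exact pow_eq_zero_iff two_ne_zero |>.1 (by linarith)
  have hc0 : c = 0 := by
    rw [← thirdTime_thirdProfile hα (show c < blowUpTime α by linarith), hUc, thirdTime_zero hα]
  subst hc0
  simpa using And.intro hTc hE

end IsSolutionJet

/-! ### Series in powers of `e^{aτ}` -/

/-- `∑ lᵖ c_l e^{laτ}`; up to the factor `aᵖ`, the `p`-th derivative of `∑ c_l e^{laτ}`. -/
noncomputable def expSeries (a : ℝ) (c : ℕ → ℝ) (p : ℕ) (τ : ℝ) : ℝ :=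
  ∑' l : ℕ, (l : ℝ) ^ p * c l * Real.exp (l * a * τ)

section expSeries

variable {a A q T τ : ℝ} {c : ℕ → ℝ}

theorem summable_expSeries_majorant (A : ℝ) (hq : 0 ≤ q) (hT : q * Real.exp (a * T) < 1) (p : ℕ) :
    Summable fun l : ℕ => (l : ℝ) ^ p * (A * q ^ l) * Real.exp (l * a * T) := by
  have h := (summable_pow_mul_geometric_of_norm_lt_one (R := ℝ) p (r := q * Real.exp (a * T))
    (by rwa [Real.norm_of_nonneg (by positivity)])).mul_left A
  refine h.congr fun l => ?_
  rw [mul_pow, ← Real.exp_nat_mul]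
  ring_nf

theorem norm_expSeries_term_le (ha : 0 < a) (hc : ∀ l, |c l| ≤ A * q ^ l) (hτ : τ ≤ T)
    (p l : ℕ) : ‖(l : ℝ) ^ p * c l * Real.exp (l * a * τ)‖
      ≤ (l : ℝ) ^ p * (A * q ^ l) * Real.exp (l * a * T) := by
  rw [norm_mul, norm_mul, Real.norm_eq_abs, Real.norm_eq_abs, Real.norm_eq_abs, Real.abs_exp,
    abs_of_nonneg (by positivity : (0 : ℝ) ≤ (l : ℝ) ^ p)]
  have h1 : Real.exp (l * a * τ) ≤ Real.exp (l * a * T) :=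
    Real.exp_le_exp.2 (mul_le_mul_of_nonneg_left hτ (by positivity))
  have h2 := (abs_nonneg _).trans (hc l)
  gcongr
  exact hc l

theorem summable_norm_expSeries (ha : 0 < a) (hq : 0 ≤ q) (hc : ∀ l, |c l| ≤ A * q ^ l)
    (hT : q * Real.exp (a * T) < 1) (hτ : τ ≤ T) (p : ℕ) :
    Summable fun l : ℕ => ‖(l : ℝ) ^ p * c l * Real.exp (l * a * τ)‖ :=
  (summable_expSeries_majorant A hq hT p).of_nonneg_of_le (fun _ => norm_nonneg _)
    (norm_expSeries_term_le ha hc hτ p)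

theorem hasSum_expSeries (ha : 0 < a) (hq : 0 ≤ q) (hc : ∀ l, |c l| ≤ A * q ^ l)
    (hT : q * Real.exp (a * T) < 1) (hτ : τ ≤ T) (p : ℕ) :
    HasSum (fun l : ℕ => (l : ℝ) ^ p * c l * Real.exp (l * a * τ)) (expSeries a c p τ) :=
  (summable_norm_expSeries ha hq hc hT hτ p).of_norm.hasSum

theorem hasDerivAt_expSeries (ha : 0 < a) (hq : 0 ≤ q) (hc : ∀ l, |c l| ≤ A * q ^ l)
    (hT : q * Real.exp (a * T) < 1) (hτ : τ < T) (p : ℕ) :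
    HasDerivAt (expSeries a c p) (a * expSeries a c (p + 1) τ) τ := by
  have h := hasDerivAt_tsum_of_isPreconnected (t := Iio T)
    (g := fun (l : ℕ) τ => (l : ℝ) ^ p * c l * Real.exp (l * a * τ))
    (g' := fun (l : ℕ) τ => a * ((l : ℝ) ^ (p + 1) * c l * Real.exp (l * a * τ)))
    ((summable_expSeries_majorant A hq hT (p + 1)).mul_left a) isOpen_Iio isPreconnected_Iio
    (fun (l : ℕ) y _ => ?_) (fun (l : ℕ) y hy => ?_) hτ
    (summable_norm_expSeries ha hq hc hT hτ.le p).of_norm hτ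
  · rw [tsum_mul_left] at h
    exact h
  · refine ((((hasDerivAt_id y).const_mul (l * a)).exp).const_mul
      ((l : ℝ) ^ p * c l)).congr_deriv ?_
    simp only [id]
    ring
  · rw [norm_mul, Real.norm_of_nonneg ha.le]
    exact mul_le_mul_of_nonneg_left (norm_expSeries_term_le ha hc (le_of_lt hy) (p + 1) l) ha.le

theorem expDecay_expSeries (ha : 0 < a) (hq : 0 ≤ q) (hc : ∀ l, |c l| ≤ A * q ^ l)
    (hT : q * Real.exp (a * T) < 1) (hc0 : c 0 = 0) (p : ℕ) : ExpDecay a (expSeries a c p) := by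
  have hs := summable_expSeries_majorant A hq hT p
  refine ExpDecay.of_le_exp (T := T)
    (C := (∑' l : ℕ, (l : ℝ) ^ p * (A * q ^ l) * Real.exp (l * a * T)) * Real.exp (-(a * T)))
    fun τ hτ => ?_
  have h := tsum_of_norm_bounded (f := fun l : ℕ => (l : ℝ) ^ p * c l * Real.exp (l * a * τ))
    (hs.mul_right (Real.exp (a * (τ - T)))).hasSum fun l => ?_
  · rw [tsum_mul_right, Real.norm_eq_abs] at h
    refine h.trans_eq ?_
    rw [mul_assoc, ← Real.exp_add, mul_sub, sub_eq_neg_add]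
  · rcases Nat.eq_zero_or_pos l with rfl | hl
    · simp only [hc0, mul_zero, zero_mul, norm_zero]
      have : 0 ≤ A * q ^ 0 := (abs_nonneg _).trans (hc 0)
      positivity
    · have h1 : Real.exp (l * a * τ) ≤ Real.exp (l * a * T) * Real.exp (a * (τ - T)) := by
        rw [← Real.exp_add, Real.exp_le_exp]
        have h2 : (1 : ℝ) ≤ l := by exact_mod_cast hl
        nlinarith [mul_nonneg (mul_nonneg (sub_nonneg.2 h2) ha.le) (sub_nonneg.2 hτ)]
      rw [norm_mul, norm_mul, Real.norm_eq_abs, Real.norm_eq_abs, Real.norm_eq_abs, Real.abs_exp,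
        abs_of_nonneg (by positivity : (0 : ℝ) ≤ (l : ℝ) ^ p), mul_assoc _ (Real.exp _)]
      have h2 := (abs_nonneg _).trans (hc l)
      gcongr
      exact hc l

theorem tendsto_expSeries_div_exp (ha : 0 < a) (hq : 0 ≤ q) (hc : ∀ l, |c l| ≤ A * q ^ l)
    (hT : q * Real.exp (a * T) < 1) (hc0 : c 0 = 0) :
    Tendsto (fun τ => expSeries a c 0 τ / Real.exp (a * τ)) atBot (𝓝 (c 1)) := by
  have h := tendsto_tsum_of_dominated_convergence (𝓕 := atBot)
    (f := fun τ (l : ℕ) => c l * Real.exp ((l - 1) * a * τ))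
    (g := fun l => if l = 1 then c 1 else 0)
    ((summable_expSeries_majorant A hq hT 0).mul_right (Real.exp (-(a * T)))) (fun l => ?_) ?_
  · rw [tsum_ite_eq] at h
    refine h.congr fun τ => ?_
    rw [expSeries, ← tsum_div_const]
    refine tsum_congr fun l => ?_
    rw [pow_zero, one_mul, mul_div_assoc, ← Real.exp_sub]
    ring_nf
  · rcases lt_trichotomy l 1 with hl | rfl | hl
    · obtain rfl : l = 0 := by omega
      simp [hc0]
    · simp
    · have h2 : (0 : ℝ) < l - 1 := by
        have : (1 : ℝ) < l := by exact_mod_cast hl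
        linarith
      rw [if_neg hl.ne']
      simpa using (Real.tendsto_exp_atBot.comp
        (tendsto_id.const_mul_atBot (mul_pos h2 ha))).const_mul (c l)
  · filter_upwards [eventually_le_atBot T] with τ hτ l
    rcases Nat.eq_zero_or_pos l with rfl | hl
    · simp only [hc0, zero_mul, norm_zero]
      have : 0 ≤ A * q ^ 0 := (abs_nonneg _).trans (hc 0)
      positivity
    · have h2 : (0 : ℝ) ≤ l - 1 := by
        have : (1 : ℝ) ≤ l := by exact_mod_cast hl
        linarith
      rw [norm_mul, Real.norm_eq_abs, Real.norm_eq_abs, Real.abs_exp, pow_zero, one_mul,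
        mul_assoc (A * q ^ l), ← Real.exp_add]
      refine mul_le_mul (hc l) (Real.exp_le_exp.2 ?_) (Real.exp_pos _).le
        ((abs_nonneg _).trans (hc l))
      have := mul_le_mul_of_nonneg_left hτ (mul_nonneg h2 ha.le)
      linarith

theorem hasSum_expSeries_mul (ha : 0 < a) (hq : 0 ≤ q) (hc : ∀ l, |c l| ≤ A * q ^ l)
    (hT : q * Real.exp (a * T) < 1) (hτ : τ ≤ T) (p r : ℕ) :
    HasSum (fun n : ℕ => ∑ kl ∈ Finset.HasAntidiagonal.antidiagonal n,
      ((kl.1 : ℝ) ^ p * (kl.2 : ℝ) ^ r * (c kl.1 * c kl.2)) * Real.exp (n * a * τ))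
      (expSeries a c p τ * expSeries a c r τ) := by
  have h1 := summable_norm_expSeries ha hq hc hT hτ p
  have h2 := summable_norm_expSeries ha hq hc hT hτ r
  rw [expSeries, expSeries, tsum_mul_tsum_eq_tsum_sum_antidiagonal_of_summable_norm h1 h2]
  refine (summable_norm_sum_mul_antidiagonal_of_summable_norm h1
    h2).of_norm.hasSum.congr_fun fun n => Finset.sum_congr rfl fun kl hkl => ?_
  rw [← Finset.HasAntidiagonal.mem_antidiagonal.1 hkl]
  push_cast
  rw [add_mul, add_mul, Real.exp_add]
  ring

end expSeries

/-! ### The Lyapunov series -/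

/-- The defining recursion, for use with `rw` at a chosen index. -/
theorem lyapunovCoeff_add_two (m : WithTop ℝ) (a : ℝ) (n : ℕ) :
    lyapunovCoeff m a (n + 2) = (∑ k : Fin (n + 1),
      ((k : ℝ) + 1) * (coeffA m * (((n : ℝ) + 2) - ((k : ℝ) + 1)) - ((k : ℝ) + 1))
        * lyapunovCoeff m a ((k : ℕ) + 1) * lyapunovCoeff m a (n + 1 - (k : ℕ)))
      / (a * ((n : ℝ) + 2) ^ 2 * ((n : ℝ) + 1)) := by
  rw [lyapunovCoeff]

/-- The recursion for the Lyapunov coefficients, in the form that comes from comparing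
coefficients in the differential equation; it holds for every `n`, as `h₀ = 0`. -/
theorem lyapunovCoeff_recurrence (m : WithTop ℝ) {a : ℝ} (ha : 0 < a) (n : ℕ) :
    a * (n : ℝ) ^ 2 * (n - 1) * lyapunovCoeff m a n
      = ∑ kl ∈ Finset.HasAntidiagonal.antidiagonal n, (kl.1 : ℝ) * (coeffA m * kl.2 - kl.1)
          * (lyapunovCoeff m a kl.1 * lyapunovCoeff m a kl.2) := by
  have h0 : lyapunovCoeff m a 0 = 0 := by rw [lyapunovCoeff]
  rw [Finset.Nat.sum_antidiagonal_eq_sum_range_succ (fun k j => (k : ℝ) * (coeffA m * j - k)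
    * (lyapunovCoeff m a k * lyapunovCoeff m a j))]
  match n with
  | 0 => simp
  | 1 => simp [Finset.sum_range_succ, h0]
  | n + 2 =>
    rw [Finset.sum_range_succ, Finset.sum_range_succ', Finset.sum_range, Nat.sub_self, h0,
      lyapunovCoeff_add_two m a n]
    have hn : (a * ((n : ℝ) + 2) ^ 2 * ((n : ℝ) + 1)) ≠ 0 := by positivity
    have e : a * ((n + 2 : ℕ) : ℝ) ^ 2 * (((n + 2 : ℕ) : ℝ) - 1)
        = a * ((n : ℝ) + 2) ^ 2 * ((n : ℝ) + 1) := by push_cast; ring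
    rw [e, mul_div_cancel₀ _ hn]
    simp only [Nat.cast_zero, zero_mul, mul_zero, add_zero]
    refine Finset.sum_congr rfl fun k _ => ?_
    have hk : (k : ℕ) ≤ n := Nat.lt_succ_iff.1 k.2
    have e1 : n + 2 - ((k : ℕ) + 1) = n + 1 - k := by omega
    have e2 : ((n + 1 - (k : ℕ) : ℕ) : ℝ) = (n + 2) - ((k : ℝ) + 1) := by
      rw [Nat.cast_sub (by omega)]; push_cast; ring
    rw [e1, e2]
    push_cast
    ring

/-- The bound reproduces itself under the recursion because `|k (c j - k)| ≤ (k + j)²` for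
`|c| ≤ 2`. -/
theorem abs_lyapunovCoeff_le {m : WithTop ℝ} (hm : |coeffA m| ≤ 2) {a : ℝ} (ha : 0 < a) (n : ℕ) :
    |lyapunovCoeff m a n| ≤ a * (a⁻¹) ^ n := by
  induction n using Nat.strong_induction_on with
  | _ n ih =>
    match n with
    | 0 => rw [lyapunovCoeff]; simpa using ha.le
    | 1 => rw [lyapunovCoeff]; simp [ha.ne']
    | n + 2 =>
      rw [lyapunovCoeff_add_two, abs_div, abs_of_pos (a := a * _ * _) (by positivity),
        div_le_iff₀ (by positivity)]
      refine (Finset.abs_sum_le_sum_abs _ _).trans ?_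
      have hterm : ∀ k ∈ (Finset.univ : Finset (Fin (n + 1))),
          |((k : ℝ) + 1) * (coeffA m * (((n : ℝ) + 2) - ((k : ℝ) + 1)) - ((k : ℝ) + 1))
            * lyapunovCoeff m a ((k : ℕ) + 1) * lyapunovCoeff m a (n + 1 - (k : ℕ))|
          ≤ ((n : ℝ) + 2) ^ 2 * (a ^ 2 * (a⁻¹) ^ (n + 2)) := by
        intro k _
        have hk : (k : ℕ) ≤ n := Nat.lt_succ_iff.1 k.2
        have hk' : (k : ℝ) ≤ n := by exact_mod_cast hk
        have i1 := ih (k + 1) (by omega)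
        have i2 := ih (n + 1 - k) (by omega)
        have i3 : |lyapunovCoeff m a ((k : ℕ) + 1)| * |lyapunovCoeff m a (n + 1 - (k : ℕ))|
            ≤ a ^ 2 * (a⁻¹) ^ (n + 2) := by
          calc _ ≤ (a * (a⁻¹) ^ ((k : ℕ) + 1)) * (a * (a⁻¹) ^ (n + 1 - (k : ℕ))) :=
                mul_le_mul i1 i2 (abs_nonneg _) (by positivity)
            _ = a ^ 2 * ((a⁻¹) ^ ((k : ℕ) + 1) * (a⁻¹) ^ (n + 1 - (k : ℕ))) := by ring
            _ = _ := by rw [← pow_add]; congr 2; omega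
        have hc := abs_le.1 hm
        have hk0 : (0 : ℝ) ≤ k := by positivity
        have i4 : |((k : ℝ) + 1) * (coeffA m * (((n : ℝ) + 2) - ((k : ℝ) + 1)) - ((k : ℝ) + 1))|
            ≤ ((n : ℝ) + 2) ^ 2 := by
          have i5 : |coeffA m * (((n : ℝ) + 2) - ((k : ℝ) + 1)) - ((k : ℝ) + 1)|
              ≤ 2 * (((n : ℝ) + 2) - ((k : ℝ) + 1)) + ((k : ℝ) + 1) := by
            refine abs_le.2 ⟨?_, ?_⟩ <;> nlinarith
          rw [abs_mul, abs_of_nonneg (by positivity : (0 : ℝ) ≤ (k : ℝ) + 1)]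
          refine (mul_le_mul_of_nonneg_left i5 (by positivity)).trans ?_
          nlinarith [sq_nonneg ((n : ℝ) + 2 - (k + 1))]
        rw [mul_assoc, abs_mul, abs_mul (lyapunovCoeff _ _ _)]
        exact mul_le_mul i4 i3 (by positivity) (by positivity)
      refine (Finset.sum_le_sum hterm).trans_eq ?_
      rw [Finset.sum_const, Finset.card_univ, Fintype.card_fin, nsmul_eq_mul]
      push_cast
      ring

theorem abs_lyapunovCoeff_mul_pow_le {m : WithTop ℝ} (hm : |coeffA m| ≤ 2) {a d : ℝ} (ha : 0 < a)
    (hd : 0 ≤ d) (l : ℕ) : |lyapunovCoeff m a l * d ^ l| ≤ a * (d / a) ^ l := by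
  rw [abs_mul, abs_of_nonneg (pow_nonneg hd l), div_eq_inv_mul, mul_pow, ← mul_assoc]
  exact mul_le_mul_of_nonneg_right (abs_lyapunovCoeff_le hm ha l) (pow_nonneg hd l)

/-- `-a` plus the exponential series with the Lyapunov coefficients solves the equation where the
series is dominated by a geometric one. -/
theorem lyapunov_isSolutionJet {m : WithTop ℝ} (hm : |coeffA m| ≤ 2) {a d T : ℝ} (ha : 0 < a)
    (hd : 0 ≤ d) (hT : d / a * Real.exp (a * T) < 1) :
    IsSolutionJet (coeffA m) (Iio T)
      (fun τ => -a + expSeries a (fun l => lyapunovCoeff m a l * d ^ l) 0 τ)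
      (fun τ => a * expSeries a (fun l => lyapunovCoeff m a l * d ^ l) 1 τ)
      (fun τ => a ^ 2 * expSeries a (fun l => lyapunovCoeff m a l * d ^ l) 2 τ) := by
  have hc := abs_lyapunovCoeff_mul_pow_le hm ha hd
  have hq : 0 ≤ d / a := by positivity
  refine ⟨fun τ hτ => ?_, fun τ hτ => ?_, fun τ hτ => ?_⟩
  · exact ((hasDerivAt_expSeries ha hq hc hT hτ 0).const_add (-a)).hasDerivWithinAt
  · refine (((hasDerivAt_expSeries ha hq hc hT hτ 1).const_mul a).congr_deriv ?_).hasDerivWithinAt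
    ring
  · refine (((hasDerivAt_expSeries ha hq hc hT hτ 2).const_mul (a ^ 2)).congr_deriv
      ?_).hasDerivWithinAt
    have hτ' : τ ≤ T := le_of_lt hτ
    have s3 := (hasSum_expSeries ha hq hc hT hτ' 3).mul_left a
    have s2 := (hasSum_expSeries ha hq hc hT hτ' 2).mul_left a
    have s11 := (hasSum_expSeries_mul ha hq hc hT hτ' 1 1).mul_left (coeffA m)
    have s20 := hasSum_expSeries_mul ha hq hc hT hτ' 2 0
    have key := (s3.sub s2).unique ((s11.sub s20).congr_fun fun n => ?_)
    · linear_combination a ^ 2 * key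
    · rw [Finset.mul_sum, ← Finset.sum_sub_distrib]
      have hr := lyapunovCoeff_recurrence m ha n
      have : a * ((n : ℝ) ^ 3 * (lyapunovCoeff m a n * d ^ n) * Real.exp (n * a * τ))
          - a * ((n : ℝ) ^ 2 * (lyapunovCoeff m a n * d ^ n) * Real.exp (n * a * τ))
          = a * (n : ℝ) ^ 2 * (n - 1) * lyapunovCoeff m a n * (d ^ n * Real.exp (n * a * τ)) := by
        ring
      rw [this, hr, Finset.sum_mul]
      refine Finset.sum_congr rfl fun kl hkl => ?_
      rw [← Finset.HasAntidiagonal.mem_antidiagonal.1 hkl, pow_add]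
      ring

theorem hasLyapunovSeries_of_eqOn {m : WithTop ℝ} (hm : |coeffA m| ≤ 2) {a d T t : ℝ} (ha : 0 < a)
    (hd : 0 ≤ d) (hT : d / a * Real.exp (a * T) < 1) (ht : t ≤ T) {Φ : ℝ → ℝ}
    (hΦ : ∀ τ ≤ t, Φ τ = -a + expSeries a (fun l => lyapunovCoeff m a l * d ^ l) 0 τ) :
    HasLyapunovSeries m a d Φ := by
  refine ⟨t, fun τ hτ => ?_⟩
  have h := hasSum_expSeries ha (by positivity) (abs_lyapunovCoeff_mul_pow_le hm ha hd) hT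
    (hτ.trans ht) 0
  have h2 := (hasSum_nat_add_iff' 2).2 h
  have h0 : lyapunovCoeff m a 0 = 0 := by rw [lyapunovCoeff]
  have h1 : lyapunovCoeff m a 1 = 1 := by rw [lyapunovCoeff]
  simp only [Finset.sum_range_succ, Finset.sum_range_zero, h0, h1] at h2
  have e : Φ τ - (-a + d * Real.exp (a * τ))
      = expSeries a (fun l => lyapunovCoeff m a l * d ^ l) 0 τ
        - (0 + ((0 : ℕ) : ℝ) ^ 0 * (0 * d ^ 0) * Real.exp (((0 : ℕ) : ℝ) * a * τ)
          + ((1 : ℕ) : ℝ) ^ 0 * (1 * d ^ 1) * Real.exp (((1 : ℕ) : ℝ) * a * τ)) := by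
    rw [hΦ τ hτ]
    generalize expSeries a _ 0 τ = E
    simp only [Nat.cast_one, one_mul, zero_mul, mul_zero, one_pow, pow_one, zero_add]
    ring
  rw [e]
  refine h2.congr_fun fun l => ?_
  push_cast
  ring

theorem exists_geometric_lt_one {a d : ℝ} (ha : 0 < a) : ∃ T, d / a * Real.exp (a * T) < 1 := by
  have h : Tendsto (fun T : ℝ => d / a * Real.exp (a * T)) atBot (𝓝 0) := by
    simpa using (Real.tendsto_exp_atBot.comp (tendsto_id.const_mul_atBot ha)).const_mul (d / a)
  exact (h.eventually (gt_mem_nhds one_pos)).exists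

/-- Near `-∞` the Lyapunov series is a translate of the explicit solution; comparing the leading
coefficients of `e^{aτ}` shows that for this value of `d` the translation is trivial. -/
theorem hasLyapunovSeries_third {α : ℝ} (hα : 0 < α) {Φ : ℝ → ℝ}
    (hΦ : EqOn Φ (fun τ => -thirdProfile α τ ^ 2) (Iic 0)) :
    HasLyapunovSeries ((1 / 3 : ℝ) : WithTop ℝ) (α ^ 2)
      (2 * √3 * α ^ 2 * Real.exp (√3 * Real.pi / 6)) Φ := by
  have hs0 : 0 < √(3 : ℝ) := Real.sqrt_pos.2 (by norm_num)
  have hm' : coeffA ((1 / 3 : ℝ) : WithTop ℝ) = -2 := by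
    change ((1 / 3 : ℝ) - 1) / (1 / 3) = -2
    norm_num
  have hm : |coeffA ((1 / 3 : ℝ) : WithTop ℝ)| ≤ 2 := by rw [hm']; norm_num
  have ha : 0 < α ^ 2 := by positivity
  set d := 2 * √3 * α ^ 2 * Real.exp (√3 * Real.pi / 6) with hd_def
  have hd : 0 < d := by positivity
  obtain ⟨T, hT⟩ := exists_geometric_lt_one (d := d) ha
  have hq : 0 ≤ d / α ^ 2 := by positivity
  obtain ⟨c, hcdef⟩ : ∃ c : ℕ → ℝ,
    c = fun l => lyapunovCoeff ((1 / 3 : ℝ) : WithTop ℝ) (α ^ 2) l * d ^ l := ⟨_, rfl⟩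
  have hc : ∀ l, |c l| ≤ α ^ 2 * (d / α ^ 2) ^ l := fun l => by
    rw [hcdef]
    exact abs_lyapunovCoeff_mul_pow_le hm ha hd.le l
  have hc0 : c 0 = 0 := by rw [hcdef]; simp only; rw [lyapunovCoeff, zero_mul]
  have hc1 : c 1 = d := by rw [hcdef]; simp only; rw [lyapunovCoeff, pow_one, one_mul]
  have hj := lyapunov_isSolutionJet hm ha hd.le hT
  rw [hm', ← hcdef] at hj
  have hdec : ∀ p, Tendsto (expSeries (α ^ 2) c p) atBot (𝓝 0) := fun p =>
    (expDecay_expSeries ha hq hc hT hc0 p).tendsto_zero ha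
  have hlead : Tendsto (fun τ => expSeries (α ^ 2) c 0 τ / Real.exp (α ^ 2 * τ)) atBot (𝓝 d) := by
    have := tendsto_expSeries_div_exp ha hq hc hT hc0
    rwa [hc1] at this
  obtain ⟨t', ht'⟩ := eventually_atBot.1 (((hdec 0).eventually (gt_mem_nhds ha)).and
    (hlead.eventually (lt_mem_nhds hd)))
  set t := min t' (T - 1)
  have htT : t < T := lt_of_le_of_lt (min_le_right _ _) (by linarith)
  obtain ⟨s, hs, he⟩ := (hj.mono (fun τ hτ => lt_of_le_of_lt (mem_Iic.1 hτ) htT :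
      Iic t ⊆ Iio T)).exists_eqOn_thirdProfile_shift hα
    (by simpa using (hdec 0).const_add (-α ^ 2)) (by simpa using (hdec 1).const_mul (α ^ 2))
    (by simpa using (hdec 2).const_mul ((α ^ 2) ^ 2))
    (fun τ hτ => by linarith [(ht' τ (le_trans hτ (min_le_left _ _))).1])
    (fun τ hτ => by
      have := (ht' τ (le_trans hτ (min_le_left _ _))).2
      have := (div_pos_iff_of_pos_right (Real.exp_pos _)).1 this
      linarith)
  have hshift : Tendsto (fun τ : ℝ => τ + s) atBot atBot :=
    tendsto_atBot_add_const_right _ _ tendsto_id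
  have hlim : Tendsto (fun τ => expSeries (α ^ 2) c 0 τ / Real.exp (α ^ 2 * τ)) atBot
      (𝓝 (Real.exp (α ^ 2 * s) * ((α + α) / thirdFactor α α))) := by
    have hU := (tendsto_thirdProfile_atBot hα).comp hshift
    have hG := ((continuous_thirdFactor hα).tendsto α).comp hU
    refine (((hU.const_add α).div hG (thirdFactor_pos hα α).ne').const_mul
      (Real.exp (α ^ 2 * s))).congr' ?_
    filter_upwards [eventually_le_atBot t] with τ hτ
    have h1 := he hτ
    have h2 := sub_thirdProfile hα (show τ + s < blowUpTime α by linarith)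
    simp only at h1
    have h3 : expSeries (α ^ 2) c 0 τ
        = (α - thirdProfile α (τ + s)) * (α + thirdProfile α (τ + s)) := by linear_combination h1
    simp only [Pi.div_apply, Function.comp]
    rw [h3, h2, mul_add (α ^ 2), Real.exp_add]
    field_simp
  have hlim' := tendsto_nhds_unique hlim hlead
  have hd' : (α + α) / thirdFactor α α = d := by
    rw [thirdFactor_self hα, Real.exp_neg, hd_def]
    field_simp
    ring
  rw [hd'] at hlim'
  have hs0' : s = 0 := by
    have h1 : Real.exp (α ^ 2 * s) = 1 := mul_right_cancel₀ hd.ne' (by rw [hlim', one_mul])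
    rw [Real.exp_eq_one_iff] at h1
    exact (mul_eq_zero.1 h1).resolve_left ha.ne'
  refine hasLyapunovSeries_of_eqOn hm ha hd.le hT ((min_le_left t 0).trans htT.le) fun τ hτ => ?_
  rw [hΦ (hτ.trans (min_le_right _ _)), ← hcdef]
  have := he (hτ.trans (min_le_left _ _))
  simp only [hs0', add_zero] at this
  exact this.symm

theorem lyapunovCoeff_half {a : ℝ} (ha : 0 < a) (n : ℕ) :
    lyapunovCoeff ((1 / 2 : ℝ) : WithTop ℝ) a (n + 1) = (-(2 * a)⁻¹) ^ n := by
  induction n using Nat.strong_induction_on with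
  | _ n ih =>
    match n with
    | 0 => rw [lyapunovCoeff, pow_zero]
    | n + 1 =>
      have hm : coeffA ((1 / 2 : ℝ) : WithTop ℝ) = -1 := by
        change ((1 / 2 : ℝ) - 1) / (1 / 2) = -1
        norm_num
      rw [lyapunovCoeff_add_two, hm, div_eq_iff (by positivity)]
      have hterm : ∀ k ∈ (Finset.univ : Finset (Fin (n + 1))),
          ((k : ℝ) + 1) * (-1 * (((n : ℝ) + 2) - ((k : ℝ) + 1)) - ((k : ℝ) + 1))
            * lyapunovCoeff ((1 / 2 : ℝ) : WithTop ℝ) a ((k : ℕ) + 1)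
            * lyapunovCoeff ((1 / 2 : ℝ) : WithTop ℝ) a (n + 1 - (k : ℕ))
          = -((n : ℝ) + 2) * (-(2 * a)⁻¹) ^ n * ((k : ℕ) + 1 : ℝ) := by
        intro k _
        have hk : (k : ℕ) ≤ n := Nat.lt_succ_iff.1 k.2
        rw [ih k (by omega), show n + 1 - (k : ℕ) = (n - k) + 1 by omega, ih (n - k) (by omega),
          mul_assoc, ← pow_add, Nat.add_sub_cancel' hk]
        ring
      rw [Finset.sum_congr rfl hterm, ← Finset.mul_sum,
        ← Finset.sum_range (fun k : ℕ => (k : ℝ) + 1)]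
      have hsum : ∀ n : ℕ, ∑ k ∈ Finset.range (n + 1), ((k : ℝ) + 1) = (n + 1) * (n + 2) / 2 := by
        intro n
        induction n with
        | zero => norm_num
        | succ n ih => rw [Finset.sum_range_succ, ih]; push_cast; ring
      have hr : -(2 * a)⁻¹ * a = -1 / 2 := by field_simp
      rw [hsum, pow_succ]
      linear_combination (-(-(2 * a)⁻¹) ^ n * ((n : ℝ) + 2) ^ 2 * ((n : ℝ) + 1)) * hr

/-- For `m = 1/2` the Lyapunov series is geometric. -/
theorem hasLyapunovSeries_half {a : ℝ} (ha : 0 < a) {Φ : ℝ → ℝ}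
    (hΦ : ∀ τ ≤ 0, Φ τ = a * Real.tanh (a * τ / 2)) :
    HasLyapunovSeries ((1 / 2 : ℝ) : WithTop ℝ) a (2 * a) Φ := by
  refine ⟨-1, fun τ hτ => ?_⟩
  have hx1 : Real.exp (a * τ) < 1 := by
    rw [Real.exp_lt_one_iff]; nlinarith
  have hx0 := Real.exp_pos (a * τ)
  have hg := (hasSum_geometric_of_abs_lt_one (r := -Real.exp (a * τ))
    (by rwa [abs_neg, abs_of_pos hx0])).mul_left (-(2 * a) * Real.exp (a * τ) ^ 2)
  have hsum : Φ τ - (-a + 2 * a * Real.exp (a * τ))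
      = -(2 * a) * Real.exp (a * τ) ^ 2 * (1 - -Real.exp (a * τ))⁻¹ := by
    have h2 : Real.exp (a * τ) = Real.exp (a * τ / 2) * Real.exp (a * τ / 2) := by
      rw [← Real.exp_add]; ring_nf
    rw [hΦ τ (by linarith), Real.tanh_eq, Real.exp_neg, h2, sub_neg_eq_add]
    have := Real.exp_pos (a * τ / 2)
    field_simp
    ring
  rw [hsum]
  refine hg.congr_fun fun l => ?_
  have e : Real.exp (((l : ℝ) + 2) * a * τ) = Real.exp (a * τ) ^ (l + 2) := by
    rw [← Real.exp_nat_mul]; push_cast; ring_nf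
  rw [lyapunovCoeff_half ha (l + 1), e]
  have h1 : (-(2 * a)⁻¹) ^ (l + 1) * (2 * a) ^ (l + 1) = (-1) ^ (l + 1) := by
    rw [← mul_pow]; congr 1; field_simp
  have h2 : (-Real.exp (a * τ)) ^ l = (-1) ^ l * Real.exp (a * τ) ^ l := by
    rw [← mul_pow]; ring
  rw [h2, pow_succ (2 * a) (l + 1), ← mul_assoc, h1]
  ring

theorem lyapunovCoeff_top (a : ℝ) (n : ℕ) : lyapunovCoeff ⊤ a (n + 2) = 0 := by
  induction n using Nat.strong_induction_on with
  | _ n ih =>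
    have hm : coeffA ⊤ = 1 := rfl
    rw [lyapunovCoeff_add_two, hm, div_eq_zero_iff]
    left
    refine Finset.sum_eq_zero fun k _ => ?_
    have hk : (k : ℕ) ≤ n := Nat.lt_succ_iff.1 k.2
    rcases Nat.eq_zero_or_pos (k : ℕ) with h0 | hpos
    · rcases Nat.eq_zero_or_pos n with rfl | hn
      · simp
        norm_num
      · rw [show n + 1 - (k : ℕ) = (n - 1) + 2 by omega, ih (n - 1) (by omega), mul_zero]
    · rw [show (k : ℕ) + 1 = (k - 1) + 2 by omega, ih (k - 1) (by omega), mul_zero, zero_mul]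

/-- For `m = ∞` the Lyapunov series has no terms beyond the first. -/
theorem hasLyapunovSeries_top {a : ℝ} {Φ : ℝ → ℝ}
    (hΦ : ∀ τ ≤ 0, Φ τ = a * (Real.exp (a * τ) - 1)) : HasLyapunovSeries ⊤ a a Φ := by
  refine ⟨0, fun τ hτ => ?_⟩
  rw [hΦ τ hτ, show a * (Real.exp (a * τ) - 1) - (-a + a * Real.exp (a * τ)) = 0 by ring]
  simp only [lyapunovCoeff_top, zero_mul]
  exact hasSum_zero

/-! ### The integral identities for `m = 1/3` -/

theorem integrableOn_Iic_of_deriv_nonneg {G G' : ℝ → ℝ} {T l : ℝ}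
    (hG : ∀ τ ∈ Iic T, HasDerivWithinAt G (G' τ) (Iic T) τ) (hc : ContinuousOn G' (Iic T))
    (h0 : ∀ τ ∈ Iic T, 0 ≤ G' τ) (hl : Tendsto G atBot (𝓝 l)) :
    IntegrableOn G' (Iic T) ∧ ∫ τ in Iic T, G' τ = G T - l := by
  have hGc : ContinuousOn G (Iic T) := fun τ hτ => (hG τ hτ).continuousWithinAt
  have hi : ∀ s ≤ T, IntervalIntegrable G' volume s T := fun s hs =>
    ContinuousOn.intervalIntegrable (hc.mono (by rw [uIcc_of_le hs]; exact fun x hx => hx.2))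
  have hint : IntegrableOn G' (Iic T) := by
    refine integrableOn_Iic_of_intervalIntegral_norm_tendsto (a := fun s : ℝ => min s T)
      (l := atBot) (G T - l) T (fun s => ?_) ?_ ?_
    · exact (intervalIntegrable_iff_integrableOn_Ioc_of_le (min_le_right _ _)).1
        (hi _ (min_le_right _ _))
    · exact tendsto_atBot_mono (fun s => min_le_left s T) tendsto_id
    · refine (hl.const_sub (G T)).congr' ?_
      filter_upwards [eventually_le_atBot T] with s hs
      rw [min_eq_left hs, ← intervalIntegral.integral_eq_sub_of_hasDerivAt_of_le hs
        (hGc.mono fun x hx => hx.2)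
        (fun x hx => hasDerivAt_of_Iic (hG x hx.2.le) hx.2) (hi s hs)]
      refine intervalIntegral.integral_congr fun x hx => ?_
      rw [uIcc_of_le hs] at hx
      exact (Real.norm_of_nonneg (h0 x hx.2)).symm
  refine ⟨hint, ?_⟩
  exact integral_Iic_of_hasDerivAt_of_tendsto (hGc T self_mem_Iic)
    (fun x hx => hasDerivAt_of_Iic (hG x (Iio_subset_Iic_self hx)) hx) hint hl

namespace IsSolutionJet

variable {a T : ℝ} {f f₁ f₂ : ℝ → ℝ}

theorem integral_deriv_sq (ha : 0 < a) (h : IsSolutionJet (-2) (Iic T) f f₁ f₂)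
    (l₀ : ExpDecay a (fun τ => f τ + a)) (l₁ : ExpDecay a f₁) (l₂ : ExpDecay a f₂) :
    IntegrableOn (fun s => f₁ s ^ 2) (Iic T) ∧
      ∫ s in Iic T, f₁ s ^ 2 = -(f₂ T + f T * f₁ T) := by
  have t₀ : Tendsto f atBot (𝓝 (-a)) := by simpa using (l₀.tendsto_zero ha).sub_const a
  have := integrableOn_Iic_of_deriv_nonneg (G := fun τ => -(f₂ τ + f τ * f₁ τ))
    (G' := fun s => f₁ s ^ 2) (T := T) (l := 0) (fun τ hτ => ?_) (h.continuousOn₁.pow 2)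
    (fun τ _ => sq_nonneg _)
    (by simpa using ((l₂.tendsto_zero ha).add (t₀.mul (l₁.tendsto_zero ha))).neg)
  · simpa using this
  · refine ((h.deriv₂ τ hτ).add ((h.deriv₀ τ hτ).mul (h.deriv₁ τ hτ))).neg.congr_deriv ?_
    ring

/-- Integration by parts in disguise: `τ (f'' + f f') - f' - f² / 2` is a primitive of
`-τ (f')²`. -/
theorem integral_id_mul_deriv_sq (ha : 0 < a) (h : IsSolutionJet (-2) (Iic 0) f f₁ f₂)
    (l₀ : ExpDecay a (fun τ => f τ + a)) (l₁ : ExpDecay a f₁) (l₂ : ExpDecay a f₂)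
    (h0 : f 0 = 0) : IntegrableOn (fun s => s * f₁ s ^ 2) (Iic 0) ∧
      f₁ 0 = a ^ 2 / 2 + ∫ s in Iic 0, s * f₁ s ^ 2 := by
  have t₀ : Tendsto f atBot (𝓝 (-a)) := by simpa using (l₀.tendsto_zero ha).sub_const a
  have hlim : Tendsto (fun τ => τ * (f₂ τ + f₁ τ * f τ) - (f₁ τ + f τ ^ 2 / 2)) atBot
      (𝓝 (-(a ^ 2 / 2))) := by
    have h1 := (l₂.add (l₁.mul_tendsto t₀)).id_mul_tendsto_zero ha
    simpa using h1.sub ((l₁.tendsto_zero ha).add ((t₀.pow 2).div_const 2))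
  have := integrableOn_Iic_of_deriv_nonneg (G' := fun s => -(s * f₁ s ^ 2)) (T := 0)
    (fun τ hτ => ?_) ((continuousOn_id.mul (h.continuousOn₁.pow 2)).neg)
    (fun τ hτ => by rw [mem_Iic] at hτ; nlinarith [sq_nonneg (f₁ τ)]) hlim
  · refine ⟨by simpa using this.1.neg, ?_⟩
    have h2 := this.2
    rw [integral_neg, h0] at h2
    linarith
  · refine (((hasDerivWithinAt_id τ _).mul ((h.deriv₂ τ hτ).add
      ((h.deriv₁ τ hτ).mul (h.deriv₀ τ hτ)))).sub ((h.deriv₁ τ hτ).add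
        (((h.deriv₀ τ hτ).pow 2).div_const 2))).congr_deriv ?_
    simp only [Pi.add_apply, Pi.mul_apply, id]
    push_cast
    ring

end IsSolutionJet

/-! ### Boundary value solutions as jets -/

section bridge

variable {m : WithTop ℝ} {a c : ℝ} {S : Set ℝ} {Φ f f₁ f₂ : ℝ → ℝ}

theorem isBVPSolution_of_jet (hm : coeffB m = c + 1) (h : IsSolutionJet c (Iic 0) f f₁ f₂)
    (l₀ : ExpDecay a (fun τ => f τ + a)) (l₁ : ExpDecay a f₁) (l₂ : ExpDecay a f₂)
    (h0 : f 0 = 0) : IsBVPSolution m a f := by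
  have hu := uniqueDiffOn_Iic (0 : ℝ)
  refine ⟨h.solvesODE hu hm, limitAtBot_iff.2 ⟨l₀, l₁.congr' ?_, l₂.congr' ?_⟩, h0⟩
  · filter_upwards [eventually_le_atBot 0] with τ hτ using (h.derivWithin_eq hu hτ).symm
  · filter_upwards [eventually_le_atBot 0] with τ hτ using (h.iteratedDerivWithin_two_eq hu hτ).symm

theorem LimitAtBot.tendsto (ha : 0 < a) (h : LimitAtBot a S Φ) :
    Tendsto Φ atBot (𝓝 (-a)) ∧ Tendsto (derivWithin Φ S) atBot (𝓝 0) ∧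
      Tendsto (iteratedDerivWithin 2 Φ S) atBot (𝓝 0) := by
  obtain ⟨l₀, l₁, l₂⟩ := limitAtBot_iff.1 h
  exact ⟨by simpa using (l₀.tendsto_zero ha).sub_const a, l₁.tendsto_zero ha, l₂.tendsto_zero ha⟩

end bridge

theorem coeffB_third : coeffB ((1 / 3 : ℝ) : WithTop ℝ) = -2 + 1 := by
  change (2 * (1 / 3 : ℝ) - 1) / (1 / 3) = -2 + 1
  norm_num

theorem coeffB_half : coeffB ((1 / 2 : ℝ) : WithTop ℝ) = -1 + 1 := by
  change (2 * (1 / 2 : ℝ) - 1) / (1 / 2) = -1 + 1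
  norm_num

theorem coeffB_top : coeffB ⊤ = 1 + 1 := by
  change (2 : ℝ) = 1 + 1
  norm_num

/-! ### The three boundary value problems -/

section existence

variable {a α : ℝ}

theorem isBVPSolution_half (ha : 0 < a) :
    IsBVPSolution ((1 / 2 : ℝ) : WithTop ℝ) a (fun τ => a * Real.tanh (a * τ / 2)) := by
  have l₀ := expDecay_tanh_add ha
  have t₀ : Tendsto (fun τ => a * Real.tanh (a * τ / 2)) atBot (𝓝 (-a)) := by
    simpa using (l₀.tendsto_zero ha).sub_const a
  have l₁ : ExpDecay a (fun τ => (a ^ 2 - (a * Real.tanh (a * τ / 2)) ^ 2) / 2) :=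
    (l₀.mul_tendsto ((t₀.const_sub a).div_const 2)).congr' (Eventually.of_forall fun τ => by ring)
  refine isBVPSolution_of_jet coeffB_half (tanh_isSolutionJet a _) l₀ l₁ ?_ (by simp)
  exact (l₁.mul_tendsto t₀.neg).congr' (Eventually.of_forall fun τ => by ring)

theorem isBVPSolution_top (a : ℝ) :
    IsBVPSolution ⊤ a (fun τ => a * (Real.exp (a * τ) - 1)) := by
  have hE : ExpDecay a (fun τ => Real.exp (a * τ)) :=
    ExpDecay.of_le_exp (C := 1) (T := 0) fun τ _ => by simp
  have e : (fun τ => a * (Real.exp (a * τ) - 1)) = fun τ => -a + a * Real.exp (a * τ) := by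
    funext τ; ring
  rw [e]
  refine isBVPSolution_of_jet coeffB_top (exp_isSolutionJet a a _) ?_ (hE.const_mul _)
    (hE.const_mul _) (by simp)
  exact (hE.const_mul a).congr' (Eventually.of_forall fun τ => by ring)

theorem isBVPSolution_third (hα : 0 < α) :
    IsBVPSolution ((1 / 3 : ℝ) : WithTop ℝ) (α ^ 2) (fun τ => -thirdProfile α τ ^ 2) := by
  have hd := expDecay_sub_thirdProfile hα
  have hU := tendsto_thirdProfile_atBot hα
  have hq := ((hU.const_mul α).const_add (α ^ 2)).add (hU.pow 2)
  have hj := thirdProfile_isSolutionJet hα 0 (S := Iic 0)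
    fun τ hτ => by rw [mem_Iic] at hτ; linarith [blowUpTime_pos hα]
  simp only [add_zero] at hj
  refine isBVPSolution_of_jet coeffB_third hj ?_ ?_ ?_ (by simp [thirdProfile_zero hα])
  · exact (hd.mul_tendsto (hU.const_add α)).congr' (Eventually.of_forall fun τ => by ring)
  · exact (hd.mul_tendsto ((hU.mul hq).const_mul (2 / 3))).congr'
      (Eventually.of_forall fun τ => by ring)
  · exact (hd.mul_tendsto ((((hU.pow 3).const_mul 4).const_sub (α ^ 3)).mul
      hq |>.const_mul (-2 / 9))).congr' (Eventually.of_forall fun τ => by ring)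

end existence

section uniqueness

variable {a α : ℝ} {S : Set ℝ} {Φ : ℝ → ℝ}

theorem eqOn_tanh_of_solvesODE (ha : 0 < a) (hS : UniqueDiffOn ℝ S)
    (h : SolvesODE ((1 / 2 : ℝ) : WithTop ℝ) S Φ) (hl : LimitAtBot a S Φ) (h0 : Φ 0 = 0) {T : ℝ}
    (hT : 0 ≤ T) (hTS : Iic T ⊆ S) : EqOn Φ (fun τ => a * Real.tanh (a * τ / 2)) (Iic T) := by
  obtain ⟨t₀, t₁, t₂⟩ := hl.tendsto ha
  exact ((h.isSolutionJet hS coeffB_half).mono hTS).eqOn_tanh hT t₀ t₁ t₂ h0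

theorem eqOn_exp_of_solvesODE (ha : 0 < a) (hS : UniqueDiffOn ℝ S)
    (h : SolvesODE ⊤ S Φ) (hl : LimitAtBot a S Φ) (h0 : Φ 0 = 0) {T : ℝ}
    (hT : 0 ≤ T) (hTS : Iic T ⊆ S) : EqOn Φ (fun τ => a * (Real.exp (a * τ) - 1)) (Iic T) := by
  obtain ⟨l₀, l₁, l₂⟩ := limitAtBot_iff.1 hl
  obtain ⟨d, hd⟩ := ((h.isSolutionJet hS coeffB_top).mono hTS).exists_eqOn_exp ha l₀ l₁ l₂
  have hda : d = a := by
    have := hd hT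
    simp only [h0, mul_zero, Real.exp_zero, mul_one] at this
    linarith
  intro τ hτ
  rw [hd hτ, hda]
  ring

theorem eqOn_thirdProfile_of_solvesODE (hα : 0 < α) (hS : UniqueDiffOn ℝ S)
    (h : SolvesODE ((1 / 3 : ℝ) : WithTop ℝ) S Φ) (hl : LimitAtBot (α ^ 2) S Φ) (h0 : Φ 0 = 0)
    {T : ℝ} (hT : 0 ≤ T) (hTS : Iic T ⊆ S) :
    T < blowUpTime α ∧ EqOn Φ (fun τ => -thirdProfile α τ ^ 2) (Iic T) := by
  obtain ⟨t₀, t₁, t₂⟩ := hl.tendsto (by positivity)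
  exact ((h.isSolutionJet hS coeffB_third).mono hTS).eqOn_thirdProfile hα hT t₀ t₁ t₂ h0

end uniqueness

/-! ### Properties of the solution for `m = 1/3` -/

section third

variable {α : ℝ} {Φ : ℝ → ℝ}

theorem IsBVPSolution.eqOn_thirdProfile (hα : 0 < α)
    (h : IsBVPSolution ((1 / 3 : ℝ) : WithTop ℝ) (α ^ 2) Φ) :
    EqOn Φ (fun τ => -thirdProfile α τ ^ 2) (Iic 0) :=
  (eqOn_thirdProfile_of_solvesODE hα (uniqueDiffOn_Iic 0) h.ode h.lim h.zero le_rfl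
    Subset.rfl).2

theorem IsBVPSolution.derivs_eq_third (hα : 0 < α)
    (h : IsBVPSolution ((1 / 3 : ℝ) : WithTop ℝ) (α ^ 2) Φ) {τ : ℝ} (hτ : τ ≤ 0) :
    derivWithin Φ (Iic 0) τ = 2 / 3 * (thirdProfile α τ * (α ^ 3 - thirdProfile α τ ^ 3)) ∧
    iteratedDerivWithin 2 Φ (Iic 0) τ
      = 2 / 9 * ((α ^ 3 - 4 * thirdProfile α τ ^ 3) * (thirdProfile α τ ^ 3 - α ^ 3)) := by
  have hj := thirdProfile_isSolutionJet hα 0 (S := Iic 0)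
    fun τ hτ => by rw [mem_Iic] at hτ; linarith [blowUpTime_pos hα]
  simp only [add_zero] at hj
  have := (h.ode.isSolutionJet (uniqueDiffOn_Iic 0) coeffB_third).jet_eq_of_eqOn_Iic hj
    (h.eqOn_thirdProfile hα)
  exact ⟨this.1 hτ, this.2 hτ⟩

theorem thirdProfile_nonneg (hα : 0 < α) {τ : ℝ} (hτ : τ ≤ 0) : 0 ≤ thirdProfile α τ := by
  rw [← thirdProfile_zero hα]
  exact (strictAntiOn_thirdProfile hα).antitoneOn (lt_of_le_of_lt hτ (blowUpTime_pos hα))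
    (blowUpTime_pos hα) hτ

theorem strictMonoOn_neg_thirdProfile_sq (hα : 0 < α) :
    StrictMonoOn (fun τ => -thirdProfile α τ ^ 2) (Iic 0) := fun τ hτ σ hσ hlt => by
  have h1 := strictAntiOn_thirdProfile hα (lt_of_le_of_lt hτ (blowUpTime_pos hα))
    (lt_of_le_of_lt hσ (blowUpTime_pos hα)) hlt
  have h2 := thirdProfile_nonneg hα hσ
  exact neg_lt_neg (pow_lt_pow_left₀ h1 h2 two_ne_zero)

theorem tauThird_sq (hα : 0 < α) {y : ℝ} (hy : y ≤ 0) :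
    tauThird (α ^ 2) y = thirdTime α √(-y) := by
  have h1 : √(α ^ 2) = α := Real.sqrt_sq hα.le
  have h2 : √(-α ^ 2 * y) = α * √(-y) := by
    rw [show -α ^ 2 * y = α ^ 2 * -y by ring, Real.sqrt_mul (by positivity), h1]
  have h3 : √(3 * α ^ 2) = √3 * α := by rw [Real.sqrt_mul (by norm_num), h1]
  rw [tauThird, thirdTime, h1, h2, h3, Real.sq_sqrt (by linarith)]
  ring_nf

/-- The implicit formula: `tauThird` inverts `τ ↦ -(thirdProfile α τ)²` on `(-α², 0]`. -/
theorem eq_tauThird_iff (hα : 0 < α) {τ : ℝ} (hτ : τ ≤ 0) {y : ℝ} (hy : -α ^ 2 < y) (hy0 : y ≤ 0) :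
    τ = tauThird (α ^ 2) y ↔ y = -thirdProfile α τ ^ 2 := by
  rw [tauThird_sq hα hy0]
  constructor
  · rintro rfl
    have : √(-y) < α := by rw [Real.sqrt_lt' hα]; linarith
    rw [thirdProfile_thirdTime hα this, Real.sq_sqrt (by linarith), neg_neg]
  · rintro rfl
    rw [neg_neg, Real.sqrt_sq (thirdProfile_nonneg hα hτ),
      thirdTime_thirdProfile hα (lt_of_le_of_lt hτ (blowUpTime_pos hα))]

/-- The second derivative changes sign exactly once, where `4 u³ = α³`. -/
theorem IsBVPSolution.exists_inflection_third (hα : 0 < α)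
    (h : IsBVPSolution ((1 / 3 : ℝ) : WithTop ℝ) (α ^ 2) Φ) : ∃ τin : ℝ, τin < 0 ∧
      (∀ τ < τin, 0 < iteratedDerivWithin 2 Φ (Iic 0) τ) ∧
      iteratedDerivWithin 2 Φ (Iic 0) τin = 0 ∧
      (∀ τ, τin < τ → τ ≤ 0 → iteratedDerivWithin 2 Φ (Iic 0) τ < 0) := by
  obtain ⟨β, hβ0, hβ⟩ : ∃ β : ℝ, 0 < β ∧ β ^ 3 = α ^ 3 / 4 := by
    refine ⟨(α ^ 3 / 4) ^ ((3 : ℕ) : ℝ)⁻¹, by positivity, ?_⟩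
    exact Real.rpow_inv_natCast_pow (by positivity) (by norm_num)
  have hα3 : 0 < α ^ 3 := by positivity
  have hβα : β < α := lt_of_pow_lt_pow_left₀ 3 hα.le (by rw [hβ]; linarith)
  have hin : thirdTime α β < 0 := by
    rw [← thirdTime_zero hα]
    exact strictAntiOn_thirdTime hα hα hβα hβ0
  have hcube : ∀ τ ≤ 0, thirdProfile α τ ^ 3 - α ^ 3 < 0 := fun τ hτ =>
    sub_neg.2 (pow_lt_pow_left₀ (thirdProfile_lt hα (lt_of_le_of_lt hτ (blowUpTime_pos hα)))
      (thirdProfile_nonneg hα hτ) (by norm_num))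
  refine ⟨thirdTime α β, hin, fun τ hτ => ?_, ?_, fun τ hτ hτ0 => ?_⟩
  · have hτ0 : τ ≤ 0 := (hτ.trans hin).le
    rw [(h.derivs_eq_third hα hτ0).2]
    have h1 := (lt_thirdProfile_iff hα (lt_of_le_of_lt hτ0 (blowUpTime_pos hα)) hβα).2 hτ
    have h2 := pow_lt_pow_left₀ h1 hβ0.le three_ne_zero
    have := mul_pos_of_neg_of_neg (by linarith : α ^ 3 - 4 * thirdProfile α τ ^ 3 < 0) (hcube τ hτ0)
    positivity
  · rw [(h.derivs_eq_third hα hin.le).2, thirdProfile_thirdTime hα hβα, hβ]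
    ring
  · rw [(h.derivs_eq_third hα hτ0).2]
    have h1 := (thirdProfile_lt_iff hα (lt_of_le_of_lt hτ0 (blowUpTime_pos hα)) hβα).2 hτ
    have h2 := pow_lt_pow_left₀ h1 (thirdProfile_nonneg hα hτ0) three_ne_zero
    have := mul_neg_of_pos_of_neg (by linarith : 0 < α ^ 3 - 4 * thirdProfile α τ ^ 3) (hcube τ hτ0)
    linarith

theorem IsBVPSolution.blowUp_third (hα : 0 < α)
    (h : IsBVPSolution ((1 / 3 : ℝ) : WithTop ℝ) (α ^ 2) Φ) : ∃ Ψ : ℝ → ℝ,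
      SolvesODE ((1 / 3 : ℝ) : WithTop ℝ) (Iio (blowUpTime α)) Ψ ∧ EqOn Ψ Φ (Iic 0) ∧
      Tendsto Ψ (𝓝[<] (blowUpTime α)) atBot := by
  have hj := thirdProfile_isSolutionJet hα 0 (S := Iio (blowUpTime α))
    fun τ hτ => by simpa using hτ
  simp only [add_zero] at hj
  refine ⟨_, hj.solvesODE isOpen_Iio.uniqueDiffOn coeffB_third, (h.eqOn_thirdProfile hα).symm, ?_⟩
  have h3 := tendsto_thirdProfile_blowUpTime hα
  exact (tendsto_neg_atTop_atBot.comp (h3.atBot_mul_atBot₀ h3)).congr fun τ => by simp [sq]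

theorem IsBVPSolution.not_extends_third (hα : 0 < α)
    (h : IsBVPSolution ((1 / 3 : ℝ) : WithTop ℝ) (α ^ 2) Φ) {T : ℝ} (hT : blowUpTime α < T) :
    ¬ ∃ Ψ : ℝ → ℝ, SolvesODE ((1 / 3 : ℝ) : WithTop ℝ) (Iio T) Ψ ∧ EqOn Ψ Φ (Iic 0) := by
  rintro ⟨Ψ, hΨ, hE⟩
  have hb := blowUpTime_pos hα
  have := ((hΨ.isSolutionJet isOpen_Iio.uniqueDiffOn coeffB_third).mono
    (fun τ hτ => lt_of_le_of_lt (mem_Iic.1 hτ) hT :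
      Iic (blowUpTime α) ⊆ Iio T)).eqOn_thirdProfile_shift hα (t := 0) (c := 0) hb.le
      (by simpa using hb)
      (by simpa using hE.trans (h.eqOn_thirdProfile hα))
  simpa using this.1

end third

/-! ### Nonexistence on the whole line -/

section wholeLine

variable {a α b : ℝ}

theorem not_isIBVPSolution_third (hα : 0 < α) (Φ : ℝ → ℝ) :
    ¬ IsIBVPSolution ((1 / 3 : ℝ) : WithTop ℝ) (α ^ 2) b Φ := fun h =>
  lt_irrefl _ (eqOn_thirdProfile_of_solvesODE hα uniqueDiffOn_univ h.ode h.lim h.zero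
    (blowUpTime_pos hα).le (subset_univ _)).1

theorem not_isIBVPSolution_half (ha : 0 < a) (hb : b ≠ 0) (Φ : ℝ → ℝ) :
    ¬ IsIBVPSolution ((1 / 2 : ℝ) : WithTop ℝ) a b Φ := fun h => by
  have hg : Tendsto (fun τ : ℝ => Φ τ / τ ^ (1 / 2 : ℝ)) atTop (𝓝 b) := h.growth
  refine hb (tendsto_nhds_unique hg ?_)
  have h1 : Tendsto (fun τ : ℝ => a / τ ^ (1 / 2 : ℝ)) atTop (𝓝 0) :=
    (tendsto_rpow_atTop (by norm_num)).const_div_atTop a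
  refine squeeze_zero_norm' ?_ h1
  filter_upwards [eventually_gt_atTop 0] with τ hτ
  rw [eqOn_tanh_of_solvesODE ha uniqueDiffOn_univ h.ode h.lim h.zero hτ.le (subset_univ _)
    self_mem_Iic, norm_div, Real.norm_eq_abs, Real.norm_of_nonneg (by positivity)]
  have h2 : |a * Real.tanh (a * τ / 2)| ≤ a := by
    rw [abs_mul, abs_of_pos ha]
    exact mul_le_of_le_one_right ha.le (Real.abs_tanh_lt_one _).le
  gcongr

theorem not_isIBVPSolution_top (ha : 0 < a) (Φ : ℝ → ℝ) : ¬ IsIBVPSolution ⊤ a b Φ := fun h => by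
  obtain ⟨k, hk⟩ : ∃ k : ℝ, Tendsto (fun τ : ℝ => Φ τ / τ ^ k) atTop (𝓝 b) := h.growth
  refine not_tendsto_nhds_of_tendsto_atTop ?_ _ hk
  refine tendsto_atTop_mono' atTop ?_
    ((tendsto_exp_mul_div_rpow_atTop k a ha).const_mul_atTop (by positivity : 0 < a / 2))
  have h2 : Tendsto (fun τ : ℝ => Real.exp (a * τ)) atTop atTop :=
    Real.tendsto_exp_atTop.comp (tendsto_id.const_mul_atTop ha)
  filter_upwards [eventually_gt_atTop 0, h2.eventually_ge_atTop 2] with τ hτ hτ2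
  rw [eqOn_exp_of_solvesODE ha uniqueDiffOn_univ h.ode h.lim h.zero hτ.le (subset_univ _)
    self_mem_Iic, ← mul_div_assoc]
  have : 0 < τ ^ k := Real.rpow_pos_of_pos hτ k
  gcongr
  nlinarith

end wholeLine

/-! ### Convexity -/

theorem convexOn_of_jet {c : ℝ} {f f₁ f₂ : ℝ → ℝ} {T : ℝ} (h : IsSolutionJet c (Iic T) f f₁ f₂)
    (h₂ : ∀ τ ∈ Iic T, 0 ≤ f₂ τ) : ConvexOn ℝ (Iic T) f := by
  have hanti := antitoneOn_Iic_of_deriv_nonpos (fun τ hτ => (h.deriv₁ τ hτ).neg)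
    fun τ hτ => neg_nonpos.2 (h₂ τ hτ)
  have hd : ∀ τ ∈ Iio T, HasDerivAt f (f₁ τ) τ := fun τ hτ =>
    hasDerivAt_of_Iic (h.deriv₀ τ (Iio_subset_Iic_self hτ)) hτ
  refine MonotoneOn.convexOn_of_deriv (convex_Iic T) h.continuousOn₀ ?_ ?_ <;> rw [interior_Iic]
  · exact fun τ hτ => (hd τ hτ).differentiableAt.differentiableWithinAt
  · intro τ hτ σ hσ hle
    rw [(hd τ hτ).deriv, (hd σ hσ).deriv]
    exact neg_le_neg_iff.1 (hanti (Iio_subset_Iic_self hτ) (Iio_subset_Iic_self hσ) hle)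

/-! ### Values at the origin for `m = 1/2` and `m = ∞` -/

section values

variable {a : ℝ} {Φ : ℝ → ℝ}

theorem tanh_deriv_pos (ha : 0 < a) (τ : ℝ) :
    0 < (a ^ 2 - (a * Real.tanh (a * τ / 2)) ^ 2) / 2 := by
  have h1 := Real.tanh_sq_lt_one (a * τ / 2)
  have h2 : 0 < a ^ 2 := by positivity
  rw [mul_pow]
  nlinarith

theorem strictMono_tanh (ha : 0 < a) : StrictMono fun τ => a * Real.tanh (a * τ / 2) :=
  strictMono_of_hasDerivAt_pos (fun τ => hasDerivWithinAt_univ.1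
    ((tanh_isSolutionJet a univ).deriv₀ τ (mem_univ τ))) (tanh_deriv_pos ha)

theorem IsBVPSolution.half (ha : 0 < a) (h : IsBVPSolution ((1 / 2 : ℝ) : WithTop ℝ) a Φ) :
    (∀ τ ≤ 0, Φ τ = a * Real.tanh (a * τ / 2)) ∧ derivWithin Φ (Iic 0) 0 = a ^ 2 / 2 ∧
      iteratedDerivWithin 2 Φ (Iic 0) 0 = 0 ∧ ConvexOn ℝ (Iic 0) Φ := by
  have he := eqOn_tanh_of_solvesODE ha (uniqueDiffOn_Iic 0) h.ode h.lim h.zero le_rfl Subset.rfl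
  have hj := (h.ode.isSolutionJet (uniqueDiffOn_Iic 0) coeffB_half).jet_eq_of_eqOn_Iic
    (tanh_isSolutionJet a (Iic 0)) he
  refine ⟨fun τ hτ => he hτ, by simpa using hj.1 self_mem_Iic, by simpa using hj.2 self_mem_Iic, ?_⟩
  refine (convexOn_of_jet (tanh_isSolutionJet a (Iic 0)) fun τ hτ => ?_).congr he.symm
  have h1 : a * Real.tanh (a * τ / 2) ≤ 0 := by
    simpa using (strictMono_tanh ha).monotone hτ
  exact mul_nonneg (neg_nonneg.2 h1) (tanh_deriv_pos ha τ).le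

theorem IsBVPSolution.top (ha : 0 < a) (h : IsBVPSolution ⊤ a Φ) :
    (∀ τ ≤ 0, Φ τ = a * (Real.exp (a * τ) - 1)) ∧ derivWithin Φ (Iic 0) 0 = a ^ 2 ∧
      iteratedDerivWithin 2 Φ (Iic 0) 0 = a ^ 3 ∧ ConvexOn ℝ (Iic 0) Φ := by
  have he := eqOn_exp_of_solvesODE ha (uniqueDiffOn_Iic 0) h.ode h.lim h.zero le_rfl Subset.rfl
  have he' : EqOn Φ (fun τ => -a + a * Real.exp (a * τ)) (Iic 0) := fun τ hτ => by
    rw [he hτ]; ring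
  have hj := (h.ode.isSolutionJet (uniqueDiffOn_Iic 0) coeffB_top).jet_eq_of_eqOn_Iic
    (exp_isSolutionJet a a (Iic 0)) he'
  refine ⟨fun τ hτ => he hτ, ?_, ?_, ?_⟩
  · rw [hj.1 self_mem_Iic]; simp; ring
  · rw [hj.2 self_mem_Iic]; simp; ring
  · exact (convexOn_of_jet (exp_isSolutionJet a a (Iic 0)) fun τ _ => by positivity).congr he'.symm

end values

end MixingLayer

open MixingLayer in
theorem proposition3 (a : ℝ) (ha : 0 < a) :
    -- existence, uniqueness, monotonicity
    (∀ m : WithTop ℝ,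
      (m = ((1 / 3 : ℝ) : WithTop ℝ) ∨ m = ((1 / 2 : ℝ) : WithTop ℝ) ∨ m = ⊤) →
        ∃ Φ : ℝ → ℝ, MixingLayer.IsBVPSolution m a Φ ∧ StrictMonoOn Φ (Set.Iic 0) ∧
          ∀ Ψ : ℝ → ℝ, MixingLayer.IsBVPSolution m a Ψ → Set.EqOn Ψ Φ (Set.Iic 0)) ∧
    -- the case m = 1/3
    (∀ Φ : ℝ → ℝ, MixingLayer.IsBVPSolution ((1 / 3 : ℝ) : WithTop ℝ) a Φ →
      (∀ τ ≤ 0, -a < Φ τ ∧ Φ τ ≤ 0 ∧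
        ∀ y : ℝ, -a < y → y ≤ 0 → (τ = MixingLayer.tauThird a y ↔ y = Φ τ)) ∧
      MeasureTheory.IntegrableOn
        (fun s => (derivWithin Φ (Set.Iic 0) s) ^ 2) (Set.Iic 0) ∧
      MeasureTheory.IntegrableOn
        (fun s => s * (derivWithin Φ (Set.Iic 0) s) ^ 2) (Set.Iic 0) ∧
      Φ 0 = 0 ∧
      derivWithin Φ (Set.Iic 0) 0
        = a ^ 2 / 2 + ∫ s in Set.Iic 0, s * (derivWithin Φ (Set.Iic 0) s) ^ 2 ∧
      derivWithin Φ (Set.Iic 0) 0 = 0 ∧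
      iteratedDerivWithin 2 Φ (Set.Iic 0) 0
        = -∫ s in Set.Iic 0, (derivWithin Φ (Set.Iic 0) s) ^ 2 ∧
      iteratedDerivWithin 2 Φ (Set.Iic 0) 0 = -(2 * a ^ 3 / 9) ∧
      MixingLayer.HasLyapunovSeries ((1 / 3 : ℝ) : WithTop ℝ) a
        (2 * √3 * a * Real.exp (√3 * Real.pi / 6)) Φ ∧
      (∃ τin : ℝ, τin < 0 ∧
        (∀ τ < τin, 0 < iteratedDerivWithin 2 Φ (Set.Iic 0) τ) ∧
        iteratedDerivWithin 2 Φ (Set.Iic 0) τin = 0 ∧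
        (∀ τ, τin < τ → τ ≤ 0 → iteratedDerivWithin 2 Φ (Set.Iic 0) τ < 0) ∧
        (∀ τ ≤ 0, (Φ τ * derivWithin Φ (Set.Iic 0) τ
            = -∫ s in Set.Iic τ, (derivWithin Φ (Set.Iic 0) s) ^ 2) ↔ τ = τin))) ∧
    -- the case m = 1/2
    (∀ Φ : ℝ → ℝ, MixingLayer.IsBVPSolution ((1 / 2 : ℝ) : WithTop ℝ) a Φ →
      (∀ τ ≤ 0, Φ τ = a * Real.tanh (a * τ / 2)) ∧
      Φ 0 = 0 ∧
      derivWithin Φ (Set.Iic 0) 0 = a ^ 2 / 2 ∧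
      iteratedDerivWithin 2 Φ (Set.Iic 0) 0 = 0 ∧
      MixingLayer.HasLyapunovSeries ((1 / 2 : ℝ) : WithTop ℝ) a (2 * a) Φ ∧
      ConvexOn ℝ (Set.Iic 0) Φ) ∧
    MixingLayer.SolvesODE ((1 / 2 : ℝ) : WithTop ℝ) Set.univ
      (fun τ => a * Real.tanh (a * τ / 2)) ∧
    -- the case m = ∞
    (∀ Φ : ℝ → ℝ, MixingLayer.IsBVPSolution ⊤ a Φ →
      (∀ τ ≤ 0, Φ τ = a * (Real.exp (a * τ) - 1)) ∧
      Φ 0 = 0 ∧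
      derivWithin Φ (Set.Iic 0) 0 = a ^ 2 ∧
      iteratedDerivWithin 2 Φ (Set.Iic 0) 0 = a ^ 3 ∧
      MixingLayer.HasLyapunovSeries ⊤ a a Φ ∧
      ConvexOn ℝ (Set.Iic 0) Φ) ∧
    MixingLayer.SolvesODE ⊤ Set.univ (fun τ => a * (Real.exp (a * τ) - 1)) ∧
    -- the problem on the whole line has no solutions
    (∀ m : WithTop ℝ,
      (m = ((1 / 3 : ℝ) : WithTop ℝ) ∨ m = ((1 / 2 : ℝ) : WithTop ℝ) ∨ m = ⊤) →
        ∀ b : ℝ, b ≠ 0 → ¬ ∃ Φ : ℝ → ℝ, MixingLayer.IsIBVPSolution m a b Φ) ∧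
    -- blow-up for m = 1/3
    (∀ Φ : ℝ → ℝ, MixingLayer.IsBVPSolution ((1 / 3 : ℝ) : WithTop ℝ) a Φ →
      (∃ Ψ : ℝ → ℝ,
        MixingLayer.SolvesODE ((1 / 3 : ℝ) : WithTop ℝ)
          (Set.Iio (2 * Real.pi * √3 / (3 * a))) Ψ ∧
        Set.EqOn Ψ Φ (Set.Iic 0) ∧
        Filter.Tendsto Ψ (nhdsWithin (2 * Real.pi * √3 / (3 * a))
          (Set.Iio (2 * Real.pi * √3 / (3 * a)))) Filter.atBot) ∧
      ∀ T : ℝ, 2 * Real.pi * √3 / (3 * a) < T →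
        ¬ ∃ Ψ : ℝ → ℝ, MixingLayer.SolvesODE ((1 / 3 : ℝ) : WithTop ℝ) (Set.Iio T) Ψ ∧
          Set.EqOn Ψ Φ (Set.Iic 0)) := by
  have hu := uniqueDiffOn_Iic (0 : ℝ)
  obtain ⟨α, hα, rfl⟩ : ∃ α : ℝ, 0 < α ∧ a = α ^ 2 :=
    ⟨√a, Real.sqrt_pos.2 ha, (Real.sq_sqrt ha.le).symm⟩
  refine ⟨?_, ?_, ?_, ?_, ?_, ?_, ?_, ?_⟩
  · rintro m (rfl | rfl | rfl)
    · exact ⟨_, isBVPSolution_third hα, strictMonoOn_neg_thirdProfile_sq hα,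
        fun Ψ h => h.eqOn_thirdProfile hα⟩
    · refine ⟨_, isBVPSolution_half ha, (strictMono_tanh ha).strictMonoOn _,
        fun Ψ h => (h.half ha).1⟩
    · refine ⟨_, isBVPSolution_top (α ^ 2), fun τ _ σ _ hlt => ?_, fun Ψ h => (h.top ha).1⟩
      simp only
      gcongr
  · intro Φ h
    have he := h.eqOn_thirdProfile hα
    have hj := h.ode.isSolutionJet hu coeffB_third
    obtain ⟨l₀, l₁, l₂⟩ := limitAtBot_iff.1 h.lim
    have hsq := hj.integral_deriv_sq ha l₀ l₁ l₂
    have hid := hj.integral_id_mul_deriv_sq ha l₀ l₁ l₂ h.zero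
    obtain ⟨d₁, d₂⟩ := h.derivs_eq_third hα le_rfl
    rw [thirdProfile_zero hα] at d₁ d₂
    refine ⟨fun τ hτ => ?_, hsq.1, hid.1, h.zero, hid.2, by rw [d₁]; ring, ?_, by rw [d₂]; ring,
      hasLyapunovSeries_third hα he, ?_⟩
    · have hlt := thirdProfile_lt hα (lt_of_le_of_lt hτ (blowUpTime_pos hα))
      have hnn := thirdProfile_nonneg hα hτ
      refine ⟨?_, ?_, fun y hy hy0 => ?_⟩
      · rw [he hτ]; simp only; nlinarith
      · rw [he hτ]; simp only; nlinarith
      · rw [he hτ]; exact eq_tauThird_iff hα hτ hy hy0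
    · rw [hsq.2, h.zero]; ring
    · obtain ⟨τin, h0, hpos, hz, hneg⟩ := h.exists_inflection_third hα
      refine ⟨τin, h0, hpos, hz, hneg, fun τ hτ => ?_⟩
      -- The condition says `Φ'' = 0`, since `Φ'' + Φ Φ' = -∫ (Φ')²`.
      rw [((hj.mono (Iic_subset_Iic.2 hτ)).integral_deriv_sq ha l₀ l₁ l₂).2, neg_neg]
      constructor
      · intro heq
        have hz' : iteratedDerivWithin 2 Φ (Iic 0) τ = 0 := by linarith
        rcases lt_trichotomy τ τin with hlt | heq | hgt
        · exact absurd hz' (hpos τ hlt).ne'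
        · exact heq
        · exact absurd hz' (hneg τ hgt hτ).ne
      · rintro rfl
        rw [hz, zero_add]
  · intro Φ h
    obtain ⟨e, d₁, d₂, hc⟩ := h.half ha
    exact ⟨e, h.zero, d₁, d₂, hasLyapunovSeries_half ha e, hc⟩
  · exact (tanh_isSolutionJet (α ^ 2) univ).solvesODE uniqueDiffOn_univ coeffB_half
  · intro Φ h
    obtain ⟨e, d₁, d₂, hc⟩ := h.top ha
    exact ⟨e, h.zero, d₁, d₂, hasLyapunovSeries_top e, hc⟩
  · have e : (fun τ => α ^ 2 * (Real.exp (α ^ 2 * τ) - 1))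
        = fun τ => -α ^ 2 + α ^ 2 * Real.exp (α ^ 2 * τ) := by funext τ; ring
    rw [e]
    exact (exp_isSolutionJet (α ^ 2) (α ^ 2) univ).solvesODE uniqueDiffOn_univ coeffB_top
  · rintro m (rfl | rfl | rfl) b hb ⟨Φ, h⟩
    · exact not_isIBVPSolution_third hα Φ h
    · exact not_isIBVPSolution_half ha hb Φ h
    · exact not_isIBVPSolution_top ha Φ h
  · exact fun Φ h => ⟨h.blowUp_third hα, fun T hT => h.not_extends_third hα hT⟩
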